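/- Let $\mathbb D=\{z\in\mathbb C:|z|<1\}$. A radial weight is a function $\omega:\mathbb D\to[0,\infty)$, integrable with respect to area measure, with $\omega(z)=\omega(|z|)$; put $\widehat\omega(z)=\int_{|z|}^1\omega(s)\,ds$. The weight $\omega$ is called doubling, $\omega\in\mathcal D$, if there is $C\ge1$ with $\widehat\omega(r)\le C\,\widehat\omega(\frac{1+r}2)$ for all $0\le r<1$, and there are $K_0>1$, $C>1$ with $\widehat\omega(r)\ge C\,\widehat\omega\bigl(1-\frac{1-r}{K_0}\bigr)$ for all $0\le r<1$. For an analytic function $f$ on $\mathbb D$ let $M_p(r,f)=\bigl(\frac1{2\pi}\int_0^{2\pi}|f(re^{it})|^p\,dt\bigr)^{1/p}$ if $0<p<\infty$, $M_\infty(r,f)=\sup_{|z|=r}|f(z)|$, and $\|f\|_{A^{p,q}_\omega}=\bigl(\int_0^1M_p(r,f)^q\,\omega(r)\,dr\bigr)^{1/q}$; $A^{p,q}_\omega$ is the space of analytic $f$ on $\mathbb D$ with $\|f\|_{A^{p,q}_\omega}<\infty$. Let $0<p\le\infty$ (with $1/\infty=0$), $0<q<\infty$, $1<K<\infty$ and $\omega\in\mathcal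 D$. Let $\beta>0$ and $\gamma>0$ be such that, for some constant $C'>0$, $$\widehat\omega(r)\le C'\Bigl(\frac{1-r}{1-t}\Bigr)^{\beta}\widehat\omega(t)\quad(0\le r\le t<1),\qquad \int_0^t\Bigl(\frac{1-t}{1-s}\Bigr)^{\gamma}\omega(s)\,ds\le C'\,\widehat\omega(t)\quad(0\le t<1),$$ and let $M>1+\frac1p+\frac{\beta+\gamma}q$. Let $\{z_k\}_{k=0}^\infty$ be a separated sequence in $\mathbb D$, that is, there is $\delta>0$ with $\left|\frac{z_k-z_j}{1-\overline{z_k}z_j}\right|\ge\delta$ for all $k\ne j$. For each integer $j\ge0$ let $\{z_{j,l}\}_l$ denote the points of the sequence in the annulus $A_j=\{z:1-K^{-j}\le|z|<1-K^{-(j+1)}\}$. Let $\lambda=\{\lambda_{j,l}\}$ be complex numbers, indexed in the same way, with $\|\lambda\|_{\ell^{p,q}}=\bigl\|\{\|\{\lambda_{j,l}\}_l\|_{\ell^p}\}_j\bigr\|_{\ell^q}<\infty$. Then the series $$F(z)=\sum_{j,l}\lambda_{j,l}\,\frac{(1-|z_{j,l}|)^{M-\frac1p}\,\widehat\omega(z_{j,l})^{-\frac1q}}{(1-\overline{z_{j,l}}\,z)^M}$$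 converges absolutely for every $z\in\mathbb D$, $F$ is analytic in $\mathbb D$ and belongs to $A^{p,q}_\omega$, and $$\|F\|_{A^{p,q}_\omega}\le C\,\|\lambda\|_{\ell^{p,q}},$$ where the constant $C>0$ depends only on $K,M,\omega,p,q$ and $\delta$, and for $p\le1$ only on $K,M,\omega,p,q$. (If $\omega$ vanishes almost everywhere, $\widehat\omega\equiv0$ and $0^{-1/q}$ is read as $0$.) -/

import Mathlib

open MeasureTheory Set Metric
open scoped ENNReal NNReal ComplexConjugate

noncomputable section

namespace AtomicDecomp

/-- A radial weight on the unit disc: a nonnegative function, integrable over the disc with respect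
to area measure, whose value at `z` depends on `|z|` only. The values of `ω` outside the disc play
no role. -/
structure IsRadialWeight (ω : ℂ → ℝ≥0) : Prop where
  integrable : IntegrableOn (fun z => (ω z : ℝ)) (ball (0 : ℂ) 1) volume
  radial : ∀ z : ℂ, ‖z‖ < 1 → ω z = ω ((‖z‖ : ℝ) : ℂ)

/-- The tail integral `∫_r^1 ω(s) ds` as an extended nonnegative number; the value of the
associated radial function at `z` is `tail ω ‖z‖`. -/
def tail (ω : ℂ → ℝ≥0) (r : ℝ) : ℝ≥0∞ :=
  ∫⁻ s in Ioo r 1, (ω (s : ℂ) : ℝ≥0∞)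

/-- The upper doubling condition. -/
def UpperDoubling (ω : ℂ → ℝ≥0) : Prop :=
  ∃ C : ℝ, 1 ≤ C ∧ ∀ r : ℝ, 0 ≤ r → r < 1 →
    tail ω r ≤ ENNReal.ofReal C * tail ω ((1 + r) / 2)

/-- The lower (reverse) doubling condition. -/
def LowerDoubling (ω : ℂ → ℝ≥0) : Prop :=
  ∃ K C : ℝ, 1 < K ∧ 1 < C ∧ ∀ r : ℝ, 0 ≤ r → r < 1 →
    ENNReal.ofReal C * tail ω (1 - (1 - r) / K) ≤ tail ω r

/-- Doubling radial weights: both doubling conditions hold. -/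
structure IsDoublingWeight (ω : ℂ → ℝ≥0) : Prop where
  weight : IsRadialWeight ω
  upper : UpperDoubling ω
  lower : LowerDoubling ω

/-- `β` is an admissible exponent in `ω̂(r) ≤ C ((1-r)/(1-t))^β ω̂(t)`, `0 ≤ r ≤ t < 1`. -/
def IsTailExponent (ω : ℂ → ℝ≥0) (β : ℝ) : Prop :=
  0 < β ∧ ∃ C : ℝ, 0 < C ∧ ∀ r t : ℝ, 0 ≤ r → r ≤ t → t < 1 →
    tail ω r ≤ ENNReal.ofReal (C * ((1 - r) / (1 - t)) ^ β) * tail ω t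

/-- `γ` is an admissible exponent in `∫_0^t ((1-t)/(1-s))^γ ω(s) ds ≤ C ω̂(t)`, `0 ≤ t < 1`. -/
def IsIntegralExponent (ω : ℂ → ℝ≥0) (γ : ℝ) : Prop :=
  0 < γ ∧ ∃ C : ℝ, 0 < C ∧ ∀ t : ℝ, 0 ≤ t → t < 1 →
    ∫⁻ s in Ioo 0 t, ENNReal.ofReal (((1 - t) / (1 - s)) ^ γ) * (ω (s : ℂ) : ℝ≥0∞)
      ≤ ENNReal.ofReal C * tail ω t

/-- The integral mean `M_p(r, f)`, with the supremum over the circle for `p = ∞`. -/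
def integralMean (p : ℝ≥0∞) (r : ℝ) (f : ℂ → ℂ) : ℝ≥0∞ :=
  if p = ∞ then ⨆ z ∈ sphere (0 : ℂ) r, ‖f z‖ₑ
  else (ENNReal.ofReal (1 / (2 * Real.pi)) *
    ∫⁻ t in Ioo 0 (2 * Real.pi), ‖f (r * Complex.exp (t * Complex.I))‖ₑ ^ p.toReal)
      ^ (1 / p.toReal)

/-- The (quasi)norm of the weighted mixed norm space `A^{p,q}_ω`; its value is `∞` when the
defining integral diverges. -/
def mixedNorm (p : ℝ≥0∞) (q : ℝ) (ω : ℂ → ℝ≥0) (f : ℂ → ℂ) : ℝ≥0∞ :=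
  (∫⁻ r in Ioo (0 : ℝ) 1, integralMean p r f ^ q * (ω (r : ℂ) : ℝ≥0∞)) ^ (1 / q)

/-- Membership in `A^{p,q}_ω`: analytic in the unit disc with finite mixed norm. -/
def MemMixedNormSpace (p : ℝ≥0∞) (q : ℝ) (ω : ℂ → ℝ≥0) (f : ℂ → ℂ) : Prop :=
  AnalyticOnNhd ℂ f (ball (0 : ℂ) 1) ∧ mixedNorm p q ω f < ∞

/-- The `ℓ^p` (quasi)norm of a family of extended nonnegative numbers, `0 < p ≤ ∞`. -/
def seqNorm {ι : Type} (p : ℝ≥0∞) (a : ι → ℝ≥0∞) : ℝ≥0∞ :=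
  if p = ∞ then ⨆ i, a i else (∑' i, a i ^ p.toReal) ^ (1 / p.toReal)

/-- The `ℓ^{p,q}` (quasi)norm of a doubly indexed family: `ℓ^p` in the inner index `l ∈ ι j`, then
`ℓ^q` in the outer index `j`. -/
def mixedSeqNorm {ι : ℕ → Type} (p q : ℝ≥0∞) (a : (j : ℕ) → ι j → ℂ) : ℝ≥0∞ :=
  seqNorm q (fun j => seqNorm p (fun l => ‖a j l‖ₑ))

/-- The pseudohyperbolic distance. -/
def pseudoDist (a z : ℂ) : ℝ := ‖(a - z) / (1 - conj a * z)‖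

/-- `z` is a sequence in the unit disc that is separated with separation constant at least `δ`. -/
structure IsSeparatedBy (δ : ℝ) (z : ℕ → ℂ) : Prop where
  mem_disc : ∀ k, ‖z k‖ < 1
  le_dist : ∀ k j, k ≠ j → δ ≤ pseudoDist (z k) (z j)

/-- The radii `r_j = 1 - K^{-j}`. -/
def radius (K : ℝ) (j : ℕ) : ℝ := 1 - (K ^ j)⁻¹

/-- The annulus `A_j = {r_j ≤ |z| < r_{j+1}}`. -/
def annulus (K : ℝ) (j : ℕ) : Set ℂ := {z | radius K j ≤ ‖z‖ ∧ ‖z‖ < radius K (j + 1)}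

/-- The index set of the points of the sequence in the annulus `A_j`: the inner index `l` of
`z_{j,l}` runs over it, and `z_{j,l} = z l`. -/
def Idx (K : ℝ) (z : ℕ → ℂ) (j : ℕ) : Type := {k : ℕ // z k ∈ annulus K j}

/-- The atom at the point `w`:
`(1-|w|)^{M-1/p} ω̂(w)^{-1/q} / (1 - \bar w ζ)^M` (principal branch of the power; the base has
positive real part for `w`, `ζ` in the disc). -/
def atom (p : ℝ≥0∞) (q M : ℝ) (ω : ℂ → ℝ≥0) (w ζ : ℂ) : ℂ :=
  (((1 - ‖w‖) ^ (M - (p⁻¹).toReal) * (tail ω ‖w‖).toReal ^ (-1 / q) : ℝ) : ℂ) /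
    (1 - conj w * ζ) ^ (M : ℂ)

/-- The term of the series with double index `(j, l)`. -/
def atomTerm (p : ℝ≥0∞) (q K M : ℝ) (ω : ℂ → ℝ≥0) (z : ℕ → ℂ)
    (a : (j : ℕ) → Idx K z j → ℂ) (ζ : ℂ) (x : Σ j : ℕ, Idx K z j) : ℂ :=
  a x.1 x.2 * atom p q M ω (z x.2.1) ζ

/-- The function `F(ζ) = ∑_{j,l} λ_{j,l} · atom_{j,l}(ζ)`. -/
def atomSeries (p : ℝ≥0∞) (q K M : ℝ) (ω : ℂ → ℝ≥0) (z : ℕ → ℂ)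
    (a : (j : ℕ) → Idx K z j → ℂ) (ζ : ℂ) : ℂ :=
  ∑' x : Σ j : ℕ, Idx K z j, atomTerm p q K M ω z a ζ x

end AtomicDecomp

end

namespace AtomicDecomp

/-! Write `κ_j = K^{-j}` and let `T_j` be the tail of `ω` at the inner radius of `A_j`. An atom
based in `A_j` has a coefficient at most a constant times `κ_j^{M-1/p} T_j^{-1/q}`
(`exists_norm_atom_le`), so `F` is dominated by a sum over `j` of such multiples of kernel sums `∑_l
|λ_{j,l}| |1 - \bar z_{j,l} ζ|^{-M}`.

The `L^p` mean of one kernel sum over the circle of radius `r` is at most a constant times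
`κ_j^{1/p-M} (κ_j / max(κ_j, 1-r))^{M-1-1/p} ‖λ_j‖_p`. For `p ≤ 1` this follows from subadditivity
of `x ↦ x^p` and a circle integral of the kernel, without separation, so the constant is free of
`δ`. For `p > 1` it follows from Hölder's inequality with the kernel as weight; separation bounds
the total weight by an area integral over an annulus (`exists_tsum_rpow_le_of_separated`).

When `r` lies in the `k`-th band, the annulus `A_j` therefore contributes at most a constant times
`T_k^{-1/q} φ^{|j-k|} ‖λ_j‖_p` with some `φ < 1` (`exists_band_bound`). For `j ≤ k` the decay is the
geometric decay of the tail given by lower doubling; for `j ≥ k` it comes from `M - 1 - 1/p > β/q`.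
The mass of `ω` on the band is at most `T_k` and cancels the power of `T_k` in the `q`-th power of
the mean. What remains is a matrix with geometric decay off the diagonal, which is bounded on `ℓ^q`
for every `q > 0`: `rpow_tsum_le_tsum_div_rpow` spends part of the decay in place of a triangle
inequality. The same estimates at `ζ = 0` give absolute convergence there, and convergence at `0`
dominates the series on every smaller disc. -/

/-! ### Circle integrals, area integrals and separated sums of the kernel. -/

/-- The chord equals `2 |sin((t - t')/2)|`; Jordan's inequality `sin x ≥ 2x/π` applies to whichever
of `u/2` and `π - u/2` is at most `π/2`, where `u = |t - t'|`. -/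
theorem min_le_norm_exp_sub_exp {t t' : ℝ} (h : |t - t'| ≤ 2 * Real.pi) :
    2 / Real.pi * min |t - t'| (2 * Real.pi - |t - t'|) ≤
      ‖Complex.exp (t * Complex.I) - Complex.exp (t' * Complex.I)‖ := by
  have e1 : Complex.exp (t * Complex.I) - Complex.exp (t' * Complex.I) =
      Complex.exp (t' * Complex.I) * (Complex.exp (Complex.I * ((t - t' : ℝ) : ℂ)) - 1) := by
    rw [mul_sub, ← Complex.exp_add, mul_one]
    congr 2
    push_cast
    ring
  rw [e1, norm_mul, Complex.norm_exp_ofReal_mul_I, one_mul, Complex.norm_exp_I_mul_ofReal_sub_one,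
    norm_mul, Real.norm_eq_abs, Real.norm_eq_abs]
  have hpi := Real.pi_pos
  have e2 : |Real.sin ((t - t') / 2)| = Real.sin (|t - t'| / 2) := by
    rcases abs_cases (t - t') with ⟨h1, h2⟩ | ⟨h1, h2⟩
    · rw [h1, abs_of_nonneg]
      exact Real.sin_nonneg_of_nonneg_of_le_pi (by linarith) (by rw [h1] at h; linarith)
    · rw [h1, neg_div, Real.sin_neg, abs_of_nonpos]
      exact Real.sin_nonpos_of_nonpos_of_neg_pi_le (by linarith) (by rw [h1] at h; linarith)
  rw [e2, abs_of_pos (by norm_num : (0 : ℝ) < 2)]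
  set u := |t - t'| with hu
  have hu0 : 0 ≤ u := abs_nonneg _
  rcases le_total u Real.pi with h1 | h1
  · have := Real.mul_le_sin (x := u / 2) (by linarith) (by linarith)
    calc _ ≤ 2 / Real.pi * u := by gcongr; exact min_le_left _ _
      _ = 2 * (2 / Real.pi * (u / 2)) := by ring
      _ ≤ _ := by linarith
  · have := Real.mul_le_sin (x := Real.pi - u / 2) (by linarith) (by linarith)
    rw [Real.sin_pi_sub] at this
    calc _ ≤ 2 / Real.pi * (2 * Real.pi - u) := by gcongr; exact min_le_right _ _
      _ = 2 * (2 / Real.pi * (Real.pi - u / 2)) := by ring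
      _ ≤ _ := by linarith

/-- For `h > 1/2` the full period is short enough. Otherwise a nonempty set forces `‖a‖ ≥ 1/2`, and
any two of its points are within circular distance `2πh`. Unrolled to the line, the set lies in
three intervals of length `4πh`, centred at one of its points and at the two translates of that
point by a period. -/
theorem volume_norm_one_sub_lt_le {a : ℂ} (T : ℝ) {h : ℝ} (hh : 0 < h) :
    volume {t ∈ Ioo T (T + 2 * Real.pi) | ‖1 - a * Complex.exp (t * Complex.I)‖ < h} ≤
      ENNReal.ofReal (12 * Real.pi * h) := by
  have hpi := Real.pi_pos
  rcases lt_or_ge (1 / 2) h with h2 | h2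
  · calc _ ≤ volume (Ioo T (T + 2 * Real.pi)) := measure_mono (sep_subset _ _)
      _ = ENNReal.ofReal (2 * Real.pi) := by rw [Real.volume_Ioo]; congr 1; ring
      _ ≤ _ := ENNReal.ofReal_le_ofReal (by nlinarith)
  rcases eq_empty_or_nonempty
    {t ∈ Ioo T (T + 2 * Real.pi) | ‖1 - a * Complex.exp (t * Complex.I)‖ < h} with h0 | ⟨t', ht', hd'⟩
  · rw [h0]; simp
  have ha : 1 / 2 ≤ ‖a‖ := by
    have h3 : ‖a * Complex.exp (t' * Complex.I)‖ = ‖a‖ := by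
      rw [norm_mul, Complex.norm_exp_ofReal_mul_I, mul_one]
    have h4 := norm_sub_norm_le (1 : ℂ) (a * Complex.exp (t' * Complex.I))
    rw [h3, norm_one] at h4
    linarith
  have hsub : {t ∈ Ioo T (T + 2 * Real.pi) | ‖1 - a * Complex.exp (t * Complex.I)‖ < h} ⊆
      Ioo (t' - 2 * Real.pi * h) (t' + 2 * Real.pi * h) ∪
      (Ioo (t' + 2 * Real.pi - 2 * Real.pi * h) (t' + 2 * Real.pi + 2 * Real.pi * h) ∪
      Ioo (t' - 2 * Real.pi - 2 * Real.pi * h) (t' - 2 * Real.pi + 2 * Real.pi * h)) := by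
    rintro t ⟨ht, hd⟩
    have hu : |t - t'| ≤ 2 * Real.pi := by
      rw [abs_le]; constructor <;> linarith [ht.1, ht.2, ht'.1, ht'.2]
    have h5 := min_le_norm_exp_sub_exp hu
    have h6 : ‖a‖ * ‖Complex.exp (t * Complex.I) - Complex.exp (t' * Complex.I)‖ < 2 * h := by
      rw [← norm_mul]
      calc _ = ‖(1 - a * Complex.exp (t' * Complex.I)) - (1 - a * Complex.exp (t * Complex.I))‖ := by
            congr 1; ring
        _ ≤ _ := norm_sub_le _ _
        _ < 2 * h := by linarith
    have h7 : ‖Complex.exp (t * Complex.I) - Complex.exp (t' * Complex.I)‖ < 4 * h := by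
      nlinarith [norm_nonneg (Complex.exp (t * Complex.I) - Complex.exp (t' * Complex.I))]
    have h8 : min |t - t'| (2 * Real.pi - |t - t'|) < 2 * Real.pi * h := by
      have h9 := h5.trans_lt h7
      rw [div_mul_eq_mul_div, div_lt_iff₀ hpi] at h9
      linarith
    rcases min_lt_iff.1 h8 with h9 | h9
    · left
      rw [abs_lt] at h9
      constructor <;> linarith
    · right
      rcases abs_cases (t - t') with ⟨h1, h2⟩ | ⟨h1, h2⟩
      · left
        constructor <;> nlinarith
      · right
        constructor <;> nlinarith
  calc _ ≤ _ := measure_mono hsub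
    _ ≤ _ := (measure_union_le _ _).trans (add_le_add le_rfl (measure_union_le _ _))
    _ = _ := by
      rw [Real.volume_Ioo, Real.volume_Ioo, Real.volume_Ioo, ← ENNReal.ofReal_add (by nlinarith)
        (by nlinarith), ← ENNReal.ofReal_add (by nlinarith) (by nlinarith)]
      congr 1
      ring

theorem one_sub_norm_le_norm_one_sub_mul_exp (a : ℂ) (t : ℝ) :
    1 - ‖a‖ ≤ ‖1 - a * Complex.exp (t * Complex.I)‖ := by
  have h4 := norm_sub_norm_le (1 : ℂ) (a * Complex.exp (t * Complex.I))
  rwa [norm_mul, Complex.norm_exp_ofReal_mul_I, mul_one, norm_one] at h4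

/-- Dyadic decomposition by the size of `|1 - a e^{it}|`, which is at least `h = 1 - ‖a‖`: the layer
of size about `2^n h` has measure at most a constant times `2^n h` and contributes `h^{1-s}
2^{n(1-s)}` up to a constant, a convergent geometric series since `s > 1`. -/
theorem exists_lintegral_norm_one_sub_rpow_le {s : ℝ} (hs : 1 < s) :
    ∃ C : ℝ, 0 < C ∧ ∀ a : ℂ, ‖a‖ < 1 → ∀ T : ℝ,
      ∫⁻ t in Ioo T (T + 2 * Real.pi),
        ENNReal.ofReal (‖1 - a * Complex.exp (t * Complex.I)‖ ^ (-s)) ≤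
      ENNReal.ofReal (C * (1 - ‖a‖) ^ (1 - s)) := by
  have hpi := Real.pi_pos
  set x : ℝ := (2 : ℝ) ^ (1 - s) with hx
  have hx0 : 0 < x := by positivity
  have hx1 : x < 1 := Real.rpow_lt_one_of_one_lt_of_neg (by norm_num) (by linarith)
  refine ⟨24 * Real.pi * (1 - x)⁻¹, by have : 0 < 1 - x := by linarith
                                       positivity, fun a ha T => ?_⟩
  set h : ℝ := 1 - ‖a‖ with hh
  have h0 : 0 < h := by linarith
  set d : ℝ → ℝ := fun t => ‖1 - a * Complex.exp (t * Complex.I)‖ with hd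
  have hdc : Continuous d := by fun_prop
  have hdh : ∀ t, h ≤ d t := one_sub_norm_le_norm_one_sub_mul_exp a
  have key : ∀ t, ENNReal.ofReal (d t ^ (-s)) ≤
      ∑' n : ℕ, {t | d t < 2 ^ (n + 1) * h}.indicator
        (fun _ => ENNReal.ofReal ((2 ^ n * h) ^ (-s))) t := by
    intro t
    obtain ⟨n, hn1, hn2⟩ := exists_nat_pow_near (x := d t / h) (y := 2)
      ((one_le_div h0).2 (hdh t)) (by norm_num)
    rw [le_div_iff₀ h0] at hn1
    rw [div_lt_iff₀ h0] at hn2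
    refine le_trans ?_ (ENNReal.le_tsum n)
    rw [indicator_of_mem (by exact hn2)]
    exact ENNReal.ofReal_le_ofReal
      (Real.rpow_le_rpow_of_nonpos (by positivity) hn1 (by linarith))
  calc _ ≤ ∫⁻ t in Ioo T (T + 2 * Real.pi), ∑' n : ℕ, {t | d t < 2 ^ (n + 1) * h}.indicator
        (fun _ => ENNReal.ofReal ((2 ^ n * h) ^ (-s))) t := lintegral_mono key
    _ = ∑' n : ℕ, ∫⁻ t in Ioo T (T + 2 * Real.pi), {t | d t < 2 ^ (n + 1) * h}.indicator
        (fun _ => ENNReal.ofReal ((2 ^ n * h) ^ (-s))) t := by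
      refine lintegral_tsum fun n => Measurable.aemeasurable ?_
      exact measurable_const.indicator (measurableSet_lt hdc.measurable measurable_const)
    _ ≤ ∑' n : ℕ, ENNReal.ofReal (24 * Real.pi * h ^ (1 - s) * x ^ n) := by
      refine ENNReal.tsum_le_tsum fun n => ?_
      rw [lintegral_indicator (measurableSet_lt hdc.measurable measurable_const), setLIntegral_const,
        Measure.restrict_apply (measurableSet_lt hdc.measurable measurable_const)]
      have h1 := volume_norm_one_sub_lt_le (a := a) T (h := 2 ^ (n + 1) * h) (by positivity)
      have h2 : {t | d t < 2 ^ (n + 1) * h} ∩ Ioo T (T + 2 * Real.pi) =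
          {t ∈ Ioo T (T + 2 * Real.pi) |
            ‖1 - a * Complex.exp (t * Complex.I)‖ < 2 ^ (n + 1) * h} := by
        rw [inter_comm]; rfl
      rw [h2]
      refine (mul_le_mul_right h1 _).trans ?_
      rw [← ENNReal.ofReal_mul (by positivity)]
      refine ENNReal.ofReal_le_ofReal (le_of_eq ?_)
      have e1 : h ^ (1 - s) = h * h ^ (-s) := by
        rw [sub_eq_add_neg, Real.rpow_add h0, Real.rpow_one]
      have e2 : x ^ n = 2 ^ n * ((2 : ℝ) ^ n) ^ (-s) := by
        rw [hx, ← Real.rpow_natCast, ← Real.rpow_mul (by norm_num), ← Real.rpow_natCast (2 : ℝ) n,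
          ← Real.rpow_mul (by norm_num), ← Real.rpow_add (by norm_num)]
        congr 1; ring
      rw [e1, e2, Real.mul_rpow (by positivity) h0.le]
      ring
    _ = _ := by
      rw [← ENNReal.ofReal_tsum_of_nonneg (fun n => by positivity)
        ((summable_geometric_of_lt_one hx0.le hx1).mul_left _), tsum_mul_left,
        tsum_geometric_of_lt_one hx0.le hx1]
      congr 1
      ring

theorem max_div_le_one_sub_mul {K κ ρ r : ℝ} (hK : 1 ≤ K) (hκ : 0 ≤ κ) (hρ : 0 ≤ ρ)
    (hr : 0 ≤ r) (hr1 : r < 1) (h : κ / (2 * K) ≤ 1 - ρ) :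
    max κ (1 - r) / (2 * K) ≤ 1 - ρ * r := by
  have h1 : 0 ≤ κ / (2 * K) := by positivity
  rw [← max_div_div_right (by positivity), max_le_iff]
  constructor
  · nlinarith
  · calc (1 - r) / (2 * K) ≤ 1 - r := div_le_self (by linarith) (by linarith)
      _ ≤ _ := by nlinarith

theorem norm_one_sub_conj_mul_comm (w ζ : ℂ) : ‖1 - conj w * ζ‖ = ‖1 - w * conj ζ‖ := by
  rw [← Complex.norm_conj]
  simp

/-- In polar coordinates each circle contributes `max(κ, 1 - ‖ζ‖)^{1-M}` by the circle estimate, and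
the radii fill an interval of length at most `2κ`. The factors `2` in the annulus leave room for
discs around points of `A_j`. -/
theorem exists_lintegral_annulus_rpow_le {K M : ℝ} (hK : 1 ≤ K) (hM : 1 < M) :
    ∃ C : ℝ, 0 < C ∧ ∀ κ : ℝ, 0 < κ → ∀ ζ : ℂ, ‖ζ‖ < 1 →
      ∫⁻ w in {w : ℂ | κ / (2 * K) ≤ 1 - ‖w‖ ∧ 1 - ‖w‖ ≤ 2 * κ},
        ENNReal.ofReal (‖1 - conj w * ζ‖ ^ (-M)) ≤
      ENNReal.ofReal (C * κ * (max κ (1 - ‖ζ‖)) ^ (1 - M)) := by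
  obtain ⟨C, hC, hC'⟩ := exists_lintegral_norm_one_sub_rpow_le hM
  have hpi := Real.pi_pos
  refine ⟨C * ((2 * K)⁻¹ ^ (1 - M)) * 2, by positivity, fun κ hκ ζ hζ => ?_⟩
  set D := max κ (1 - ‖ζ‖) with hD
  have hD0 : 0 < D := lt_max_of_lt_left hκ
  have hS : MeasurableSet {w : ℂ | κ / (2 * K) ≤ 1 - ‖w‖ ∧ 1 - ‖w‖ ≤ 2 * κ} :=
    (measurableSet_le (f := fun _ : ℂ => κ / (2 * K)) (g := fun w : ℂ => 1 - ‖w‖)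
      measurable_const (by fun_prop)).inter
      (measurableSet_le (f := fun w : ℂ => 1 - ‖w‖) (g := fun _ : ℂ => 2 * κ)
      (by fun_prop) measurable_const)
  rw [← lintegral_indicator hS, ← Complex.lintegral_comp_polarCoord_symm, polarCoord_target,
    Measure.volume_eq_prod, ← Measure.prod_restrict]
  refine (lintegral_prod_le _).trans ?_
  set R : Set ℝ := Icc (1 - 2 * κ) (1 - κ / (2 * K))
  have hin : ∀ ρ ∈ Ioi (0 : ℝ), ∫⁻ θ in Ioo (-Real.pi) Real.pi, ENNReal.ofReal ρ •
      {w : ℂ | κ / (2 * K) ≤ 1 - ‖w‖ ∧ 1 - ‖w‖ ≤ 2 * κ}.indicator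
        (fun w => ENNReal.ofReal (‖1 - conj w * ζ‖ ^ (-M))) (Complex.polarCoord.symm (ρ, θ)) ≤
      R.indicator (fun _ => ENNReal.ofReal (C * (D / (2 * K)) ^ (1 - M))) ρ := by
    intro ρ hρ
    have hρ' : 0 < ρ := hρ
    by_cases hR : ρ ∈ R
    · rw [indicator_of_mem hR]
      have hρ1 : ρ ≤ 1 := by
        have := hR.2
        have : 0 ≤ κ / (2 * K) := by positivity
        linarith
      have hb := max_div_le_one_sub_mul hK hκ.le hρ'.le (norm_nonneg ζ) hζ
        (by linarith [hR.2] : κ / (2 * K) ≤ 1 - ρ)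
      have hn : ‖(ρ : ℂ) * conj ζ‖ = ρ * ‖ζ‖ := by
        rw [norm_mul, Complex.norm_conj, Complex.norm_of_nonneg hρ'.le]
      have hlt : ‖(ρ : ℂ) * conj ζ‖ < 1 := by
        rw [hn]
        have : 0 < max κ (1 - ‖ζ‖) / (2 * K) := by positivity
        linarith
      calc _ ≤ ∫⁻ θ in Ioo (-Real.pi) (-Real.pi + 2 * Real.pi), ENNReal.ofReal
            (‖1 - (ρ * conj ζ) * Complex.exp (θ * Complex.I)‖ ^ (-M)) := by
            rw [show -Real.pi + 2 * Real.pi = Real.pi by ring]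
            refine lintegral_mono fun θ => ?_
            rw [smul_eq_mul]
            -- The Jacobian `ρ ≤ 1` is dropped.
            refine (mul_le_of_le_one_left' (by rw [ENNReal.ofReal_le_one]; exact hρ1)).trans ?_
            refine (indicator_le_self _ _ _).trans ?_
            rw [norm_one_sub_conj_mul_comm, Complex.polarCoord_symm_apply, Complex.exp_mul_I]
            refine le_of_eq ?_
            congr 3
            push_cast
            ring
        _ ≤ _ := hC' _ hlt _
        _ ≤ _ := by
            rw [hn]
            refine ENNReal.ofReal_le_ofReal (mul_le_mul_of_nonneg_left ?_ hC.le)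
            exact Real.rpow_le_rpow_of_nonpos (by positivity) hb (by linarith)
    · rw [indicator_of_notMem hR]
      refine le_of_eq ?_
      have h0 : ∀ θ : ℝ, Complex.polarCoord.symm (ρ, θ) ∉
          {w : ℂ | κ / (2 * K) ≤ 1 - ‖w‖ ∧ 1 - ‖w‖ ≤ 2 * κ} := by
        rintro θ ⟨h1, h2⟩
        rw [Complex.norm_polarCoord_symm, abs_of_pos hρ'] at h1 h2
        exact hR ⟨by linarith, by linarith⟩
      simp_rw [indicator_of_notMem (h0 _), smul_zero, lintegral_zero]
  calc _ ≤ ∫⁻ ρ in Ioi (0 : ℝ), R.indicator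
        (fun _ => ENNReal.ofReal (C * (D / (2 * K)) ^ (1 - M))) ρ :=
        setLIntegral_mono' measurableSet_Ioi hin
    _ ≤ ∫⁻ ρ, R.indicator (fun _ => ENNReal.ofReal (C * (D / (2 * K)) ^ (1 - M))) ρ :=
        setLIntegral_le_lintegral _ _
    _ = ENNReal.ofReal (C * (D / (2 * K)) ^ (1 - M)) * volume R := by
        rw [lintegral_indicator measurableSet_Icc, setLIntegral_const]
    _ ≤ ENNReal.ofReal (C * (D / (2 * K)) ^ (1 - M)) * ENNReal.ofReal (2 * κ) := by
        gcongr
        rw [Real.volume_Icc]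
        refine ENNReal.ofReal_le_ofReal ?_
        have : 0 ≤ κ / (2 * K) := by positivity
        linarith
    _ = _ := by
        rw [← ENNReal.ofReal_mul (by positivity), div_eq_mul_inv, Real.mul_rpow hD0.le (by positivity)]
        congr 1
        ring

/-- Disjoint discs of radius comparable to `κ` surround the points, and on each the kernel is within
a factor `2^M` of its value at the centre. The sum is thus at most a constant times `κ^{-2}` times
the integral over a slightly larger annulus. -/
theorem exists_tsum_rpow_le_of_separated {K M : ℝ} (hK : 1 ≤ K) (hM : 1 < M) {δ : ℝ} (hδ : 0 < δ) :
    ∃ C : ℝ, 0 < C ∧ ∀ {ι : Type} [Countable ι] (κ : ℝ) (z : ι → ℂ), 0 < κ →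
      (∀ l, κ / K ≤ 1 - ‖z l‖) → (∀ l, 1 - ‖z l‖ ≤ κ) →
      (∀ k l, k ≠ l → δ ≤ pseudoDist (z k) (z l)) → ∀ ζ : ℂ, ‖ζ‖ < 1 →
      ∑' l, ENNReal.ofReal (‖1 - conj (z l) * ζ‖ ^ (-M)) ≤
      ENNReal.ofReal (C * κ⁻¹ * (max κ (1 - ‖ζ‖)) ^ (1 - M)) := by
  obtain ⟨C, hC, hC'⟩ := exists_lintegral_annulus_rpow_le hK hM
  have hpi := Real.pi_pos
  have hK0 : 0 < K := by linarith
  -- The factor `δ` makes the discs disjoint, since `|z_k - z_l| ≥ δ |1 - \bar z_k z_l| ≥ δ κ/K`;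
  -- the cap at `1` keeps each radius below half of `κ/K`, a lower bound for the distance to the
  -- unit circle.
  set d := min δ 1 / (2 * K) with hd
  have hm0 : 0 < min δ 1 := lt_min hδ one_pos
  have hd0 : 0 < d := by positivity
  have hdK : d ≤ 1 / (2 * K) := by rw [hd]; gcongr; exact min_le_right _ _
  refine ⟨(Real.pi * d ^ 2)⁻¹ * (2 : ℝ) ^ M * C, by positivity, ?_⟩
  intro ι _ κ z hκ hz1 hz2 hsep ζ hζ
  set ε := d * κ with hε
  have hε0 : 0 < ε := by positivity
  have hεK : ε ≤ κ / K / 2 := by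
    calc ε ≤ 1 / (2 * K) * κ := by rw [hε]; gcongr
      _ = _ := by field_simp
  have hdisj : Pairwise (Function.onFun Disjoint fun l => ball (z l) ε) := by
    intro k l hkl
    refine ball_disjoint_ball ?_
    have h1 := hsep k l hkl
    rw [pseudoDist, norm_div] at h1
    have h2 : κ / K ≤ ‖1 - conj (z k) * z l‖ := by
      have h3 := norm_sub_norm_le (1 : ℂ) (conj (z k) * z l)
      rw [norm_one, norm_mul, Complex.norm_conj] at h3
      have h4 : 0 < κ / K := by positivity
      nlinarith [hz1 k, hz1 l, norm_nonneg (z k), norm_nonneg (z l)]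
    have h5 : 0 < κ / K := by positivity
    rw [le_div_iff₀ (h5.trans_le h2)] at h1
    rw [dist_eq_norm]
    calc ε + ε = min δ 1 * (κ / K) := by rw [hε, hd]; field_simp; ring
      _ ≤ δ * ‖1 - conj (z k) * z l‖ := by gcongr; exact min_le_left _ _
      _ ≤ _ := h1
  have hpt : ∀ l, ∀ w ∈ ball (z l) ε, ENNReal.ofReal (‖1 - conj (z l) * ζ‖ ^ (-M)) ≤
      ENNReal.ofReal ((2 : ℝ) ^ M) * ENNReal.ofReal (‖1 - conj w * ζ‖ ^ (-M)) := by
    intro l w hw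
    rw [mem_ball, dist_eq_norm] at hw
    rw [← ENNReal.ofReal_mul (by positivity)]
    refine ENNReal.ofReal_le_ofReal ?_
    have h6 : κ / K ≤ ‖1 - conj (z l) * ζ‖ := by
      have h3 := norm_sub_norm_le (1 : ℂ) (conj (z l) * ζ)
      rw [norm_one, norm_mul, Complex.norm_conj] at h3
      nlinarith [hz1 l, norm_nonneg (z l), norm_nonneg ζ]
    have h4 : 0 < κ / K := by positivity
    have h7 : ‖(1 - conj w * ζ) - (1 - conj (z l) * ζ)‖ ≤ ε := by
      rw [show (1 - conj w * ζ) - (1 - conj (z l) * ζ) = - (conj (w - z l) * ζ) by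
        rw [map_sub]; ring, norm_neg, norm_mul, Complex.norm_conj]
      nlinarith [norm_nonneg (w - z l), norm_nonneg ζ]
    have h8 := norm_le_norm_add_norm_sub' (1 - conj w * ζ) (1 - conj (z l) * ζ)
    have h9 := norm_le_norm_add_norm_sub' (1 - conj (z l) * ζ) (1 - conj w * ζ)
    rw [norm_sub_rev (1 - conj (z l) * ζ) (1 - conj w * ζ)] at h9
    have hw0 : 0 < ‖1 - conj w * ζ‖ := by linarith
    calc ‖1 - conj (z l) * ζ‖ ^ (-M) ≤ (2⁻¹ * ‖1 - conj w * ζ‖) ^ (-M) :=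
          Real.rpow_le_rpow_of_nonpos (by positivity) (by linarith) (by linarith)
      _ = _ := by
          rw [Real.mul_rpow (by norm_num) (norm_nonneg _), Real.inv_rpow (by norm_num),
            Real.rpow_neg (by norm_num), inv_inv]
  have hone : ∀ l, ENNReal.ofReal (Real.pi * ε ^ 2) *
      ENNReal.ofReal (‖1 - conj (z l) * ζ‖ ^ (-M)) ≤
      ENNReal.ofReal ((2 : ℝ) ^ M) *
        ∫⁻ w in ball (z l) ε, ENNReal.ofReal (‖1 - conj w * ζ‖ ^ (-M)) := by
    intro l
    rw [← lintegral_const_mul' _ _ ENNReal.ofReal_ne_top]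
    calc _ = ∫⁻ w in ball (z l) ε, ENNReal.ofReal (‖1 - conj (z l) * ζ‖ ^ (-M)) := by
          rw [setLIntegral_const, Complex.volume_ball, mul_comm, mul_comm Real.pi,
            ENNReal.ofReal_mul (by positivity), ENNReal.ofReal_pow hε0.le]
          congr 2
          rw [← ENNReal.ofReal_coe_nnreal, NNReal.coe_real_pi]
      _ ≤ _ := setLIntegral_mono' measurableSet_ball (hpt l)
  have hsub : (⋃ l, ball (z l) ε) ⊆ {w : ℂ | κ / (2 * K) ≤ 1 - ‖w‖ ∧ 1 - ‖w‖ ≤ 2 * κ} := by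
    intro w hw
    obtain ⟨l, hl⟩ := mem_iUnion.1 hw
    rw [mem_ball, dist_eq_norm] at hl
    have h8 := norm_le_norm_add_norm_sub' w (z l)
    have h9 := norm_le_norm_add_norm_sub' (z l) w
    rw [norm_sub_rev (z l) w] at h9
    have e : κ / (2 * K) = κ / K / 2 := by field_simp
    have e2 : κ / K ≤ κ := div_le_self hκ.le hK
    constructor
    · rw [e]; linarith [hz1 l]
    · linarith [hz2 l]
  have hsum : ENNReal.ofReal (Real.pi * ε ^ 2) *
      ∑' l, ENNReal.ofReal (‖1 - conj (z l) * ζ‖ ^ (-M)) ≤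
      ENNReal.ofReal ((2 : ℝ) ^ M) * ENNReal.ofReal (C * κ * (max κ (1 - ‖ζ‖)) ^ (1 - M)) := by
    rw [← ENNReal.tsum_mul_left]
    refine (ENNReal.tsum_le_tsum hone).trans ?_
    rw [ENNReal.tsum_mul_left, ← lintegral_iUnion (fun _ => measurableSet_ball) hdisj]
    gcongr
    exact (lintegral_mono_set hsub).trans (hC' κ hκ ζ hζ)
  have hp0 : 0 < Real.pi * ε ^ 2 := by positivity
  rw [mul_comm, ← ENNReal.le_div_iff_mul_le (Or.inl (by simpa using hp0)) (Or.inl ENNReal.ofReal_ne_top)]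
    at hsum
  refine hsum.trans (le_of_eq ?_)
  rw [← ENNReal.ofReal_mul (by positivity), ← ENNReal.ofReal_div_of_pos hp0]
  congr 1
  rw [hε]
  field_simp

/-! ### Circle means of kernel sums over one annulus. -/

/-- The mean `M_p(r, g)` of an extended nonnegative function over the circle of radius `r`. -/
noncomputable def circleMean (p : ℝ≥0∞) (r : ℝ) (g : ℂ → ℝ≥0∞) : ℝ≥0∞ :=
  if p = ∞ then ⨆ z ∈ sphere (0 : ℂ) r, g z
  else (ENNReal.ofReal (1 / (2 * Real.pi)) *
    ∫⁻ t in Ioo 0 (2 * Real.pi), g (r * Complex.exp (t * Complex.I)) ^ p.toReal) ^ (1 / p.toReal)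

theorem integralMean_eq_circleMean (p : ℝ≥0∞) (r : ℝ) (f : ℂ → ℂ) :
    integralMean p r f = circleMean p r (fun z => ‖f z‖ₑ) := rfl

theorem norm_ofReal_mul_exp {r : ℝ} (hr : 0 ≤ r) (t : ℝ) :
    ‖(r : ℂ) * Complex.exp (t * Complex.I)‖ = r := by
  rw [norm_mul, Complex.norm_exp_ofReal_mul_I, mul_one, Complex.norm_of_nonneg hr]

theorem circleMean_mono {p : ℝ≥0∞} {r : ℝ} (hr : 0 ≤ r) {g h : ℂ → ℝ≥0∞}
    (H : ∀ z, ‖z‖ = r → g z ≤ h z) : circleMean p r g ≤ circleMean p r h := by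
  unfold circleMean
  split_ifs with hp
  · exact iSup₂_mono fun z hz => H z (mem_sphere_zero_iff_norm.1 hz)
  · gcongr with t
    exact H _ (norm_ofReal_mul_exp hr t)

theorem circleMean_const_mul_le {p : ℝ≥0∞} (hp : p ≠ 0) {r : ℝ} {g : ℂ → ℝ≥0∞} {c : ℝ≥0∞}
    (hc : c ≠ ∞) : circleMean p r (fun z => c * g z) ≤ c * circleMean p r g := by
  unfold circleMean
  split_ifs with h
  · simp_rw [ENNReal.mul_iSup]
    exact le_rfl
  · have hP : 0 < p.toReal := ENNReal.toReal_pos hp h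
    simp_rw [ENNReal.mul_rpow_of_nonneg _ _ hP.le]
    rw [lintegral_const_mul' _ _ (ENNReal.rpow_ne_top_of_nonneg hP.le hc), mul_left_comm,
      ENNReal.mul_rpow_of_nonneg _ _ (by positivity), ← ENNReal.rpow_mul,
      mul_one_div_cancel hP.ne', ENNReal.rpow_one]

theorem rpow_sum_le_sum_rpow {ι : Type*} (u : ι → ℝ≥0∞) {s : ℝ} (hs : 0 < s) (hs1 : s ≤ 1)
    (F : Finset ι) : (∑ i ∈ F, u i) ^ s ≤ ∑ i ∈ F, u i ^ s := by
  classical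
  induction F using Finset.induction_on with
  | empty => simp [hs]
  | insert a F ha ih =>
    rw [Finset.sum_insert ha, Finset.sum_insert ha]
    exact (ENNReal.rpow_add_le_add_rpow _ _ hs.le hs1).trans (add_le_add le_rfl ih)

theorem rpow_tsum_le_tsum_rpow {ι : Type*} (u : ι → ℝ≥0∞) {s : ℝ} (hs : 0 < s) (hs1 : s ≤ 1) :
    (∑' i, u i) ^ s ≤ ∑' i, u i ^ s := by
  rw [← ENNReal.le_rpow_inv_iff hs, ENNReal.tsum_eq_iSup_sum]
  refine iSup_le fun F => ?_
  rw [ENNReal.le_rpow_inv_iff hs]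
  exact (rpow_sum_le_sum_rpow u hs hs1 F).trans (ENNReal.sum_le_tsum F)

/-- Hölder's inequality for the measure with masses `w i`, on finite sets and then in the limit. -/
theorem rpow_tsum_mul_le {ι : Type*} (w f : ι → ℝ≥0∞) {s : ℝ} (hs : 1 ≤ s) :
    (∑' i, w i * f i) ^ s ≤ (∑' i, w i) ^ (s - 1) * ∑' i, w i * f i ^ s := by
  have hs0 : 0 < s := by linarith
  rw [← ENNReal.le_rpow_inv_iff hs0, ENNReal.tsum_eq_iSup_sum]
  refine iSup_le fun F => ?_
  refine (ENNReal.inner_le_weight_mul_Lp_of_nonneg F hs w f).trans ?_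
  have hi : s⁻¹ ≤ 1 := inv_le_one_of_one_le₀ hs
  rw [ENNReal.mul_rpow_of_nonneg _ _ (by positivity), ← ENNReal.rpow_mul,
    show (s - 1) * s⁻¹ = 1 - s⁻¹ by field_simp]
  gcongr
  · exact ENNReal.sum_le_tsum F
  · exact ENNReal.sum_le_tsum F

theorem circleMean_le_of_lintegral_le {p : ℝ≥0∞} (hp : p ≠ 0) (hp' : p ≠ ∞) {r X : ℝ} (hX : 0 ≤ X)
    {g : ℂ → ℝ≥0∞} {ι : Type} {c : ι → ℝ≥0∞}
    (H : ∫⁻ t in Ioo 0 (2 * Real.pi), g (r * Complex.exp (t * Complex.I)) ^ p.toReal ≤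
      ENNReal.ofReal (2 * Real.pi * X ^ p.toReal) * ∑' l, c l ^ p.toReal) :
    circleMean p r g ≤ ENNReal.ofReal X * seqNorm p c := by
  have hpi := Real.pi_pos
  have hP : 0 < p.toReal := ENNReal.toReal_pos hp hp'
  rw [circleMean, if_neg hp', seqNorm, if_neg hp']
  calc _ ≤ (ENNReal.ofReal (1 / (2 * Real.pi)) *
        (ENNReal.ofReal (2 * Real.pi * X ^ p.toReal) * ∑' l, c l ^ p.toReal)) ^ (1 / p.toReal) := by
        gcongr
    _ = (ENNReal.ofReal X ^ p.toReal * ∑' l, c l ^ p.toReal) ^ (1 / p.toReal) := by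
        rw [← mul_assoc, ← ENNReal.ofReal_mul (by positivity), ENNReal.ofReal_rpow_of_nonneg hX hP.le]
        congr 3
        field_simp
    _ = _ := by
        rw [ENNReal.mul_rpow_of_nonneg _ _ (by positivity), ← ENNReal.rpow_mul,
          mul_one_div_cancel hP.ne', ENNReal.rpow_one]

/-- The sum `∑ c_l |1 - \bar{z_l} ζ|^{-M}`. -/
noncomputable def kernelSum {ι : Type} (M : ℝ) (z : ι → ℂ) (c : ι → ℝ≥0∞) (ζ : ℂ) : ℝ≥0∞ :=
  ∑' l, c l * ENNReal.ofReal (‖1 - conj (z l) * ζ‖ ^ (-M))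

theorem exists_lintegral_kernel_le {K s : ℝ} (hK : 1 ≤ K) (hs : 1 < s) :
    ∃ C : ℝ, 0 < C ∧ ∀ (κ : ℝ) (w : ℂ), 0 < κ → κ / K ≤ 1 - ‖w‖ → ∀ r : ℝ, 0 ≤ r → r < 1 →
      ∫⁻ t in Ioo 0 (2 * Real.pi),
        ENNReal.ofReal (‖1 - conj w * (r * Complex.exp (t * Complex.I))‖ ^ (-s)) ≤
      ENNReal.ofReal (C * (max κ (1 - r)) ^ (1 - s)) := by
  obtain ⟨C, hC, hC'⟩ := exists_lintegral_norm_one_sub_rpow_le hs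
  have hK0 : 0 < K := by linarith
  refine ⟨C * (2 * K)⁻¹ ^ (1 - s), by positivity, fun κ w hκ hw r hr hr1 => ?_⟩
  have hD0 : 0 < max κ (1 - r) := lt_max_of_lt_left hκ
  have hb := max_div_le_one_sub_mul hK hκ.le (norm_nonneg w) hr hr1
    (le_trans (by gcongr; linarith) hw)
  have hn : ‖conj w * (r : ℂ)‖ = ‖w‖ * r := by
    rw [norm_mul, Complex.norm_conj, Complex.norm_of_nonneg hr]
  have h0 : 0 < max κ (1 - r) / (2 * K) := by positivity
  have := hC' (conj w * r) (by rw [hn]; linarith) 0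
  rw [zero_add] at this
  simp_rw [← mul_assoc]
  refine this.trans (ENNReal.ofReal_le_ofReal ?_)
  rw [hn, mul_assoc, ← Real.mul_rpow (by positivity) hD0.le, mul_comm (2 * K)⁻¹, ← div_eq_mul_inv]
  exact mul_le_mul_of_nonneg_left
    (Real.rpow_le_rpow_of_nonpos h0 hb (by linarith)) hC.le

theorem measurable_kernel (w : ℂ) (s r : ℝ) : Measurable fun t : ℝ =>
    ENNReal.ofReal (‖1 - conj w * (r * Complex.exp (t * Complex.I))‖ ^ (-s)) := by
  fun_prop

theorem rpow_div_le_of_exponent_le {κ D x y : ℝ} (hκ : 0 < κ) (hD : κ ≤ D) (h : y ≤ x) :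
    (κ / D) ^ x ≤ (κ / D) ^ y :=
  Real.rpow_le_rpow_of_exponent_ge (div_pos hκ (hκ.trans_le hD))
    ((div_le_one (hκ.trans_le hD)).2 hD) h

/-- Subadditivity of `x ↦ x^p` turns the mean into a sum of circle integrals of the kernel to the
power `M p > 1`. The points are treated one by one, so no separation enters. -/
theorem exists_circleMean_kernelSum_le_of_le_one {K M : ℝ} (hK : 1 ≤ K) {p : ℝ≥0∞} (hp : 0 < p)
    (hp1 : p ≤ 1) (hM : (p⁻¹).toReal < M) :
    ∃ B : ℝ, 0 < B ∧ ∀ {ι : Type} [Countable ι] (κ : ℝ) (z : ι → ℂ), 0 < κ →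
      (∀ l, κ / K ≤ 1 - ‖z l‖) → ∀ (c : ι → ℝ≥0∞) (r : ℝ), 0 ≤ r → r < 1 →
      circleMean p r (kernelSum M z c) ≤
        ENNReal.ofReal (B * κ ^ ((p⁻¹).toReal - M) *
          (κ / max κ (1 - r)) ^ (M - 1 - (p⁻¹).toReal)) * seqNorm p c := by
  have hpt : p ≠ ∞ := (hp1.trans_lt ENNReal.one_lt_top).ne
  have hP : 0 < p.toReal := ENNReal.toReal_pos hp.ne' hpt
  have hpi := Real.pi_pos
  have hP1 : p.toReal ≤ 1 := ENNReal.toReal_mono ENNReal.one_ne_top hp1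
  rw [ENNReal.toReal_inv] at *
  set P := p.toReal with hPdef
  have hMP : 1 < M * P := by
    rw [inv_lt_iff_one_lt_mul₀ hP] at hM
    linarith
  obtain ⟨C, hC, hC'⟩ := exists_lintegral_kernel_le hK hMP
  refine ⟨(C / (2 * Real.pi)) ^ P⁻¹, by positivity, ?_⟩
  intro ι _ κ z hκ hz c r hr hr1
  set D := max κ (1 - r) with hD
  have hD0 : 0 < D := lt_max_of_lt_left hκ
  have key : circleMean p r (kernelSum M z c) ≤
      ENNReal.ofReal ((C / (2 * Real.pi)) ^ P⁻¹ * D ^ (P⁻¹ - M)) * seqNorm p c := by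
    refine circleMean_le_of_lintegral_le hp.ne' hpt (by positivity) ?_
    calc _ ≤ ∫⁻ t in Ioo 0 (2 * Real.pi), ∑' l, c l ^ P * ENNReal.ofReal
            (‖1 - conj (z l) * (r * Complex.exp (t * Complex.I))‖ ^ (-(M * P))) := by
          refine lintegral_mono fun t => ?_
          refine (rpow_tsum_le_tsum_rpow _ hP hP1).trans (le_of_eq ?_)
          refine tsum_congr fun l => ?_
          rw [ENNReal.mul_rpow_of_nonneg _ _ hP.le, ENNReal.ofReal_rpow_of_nonneg (by positivity) hP.le,
            ← Real.rpow_mul (norm_nonneg _), neg_mul]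
      _ = ∑' l, ∫⁻ t in Ioo 0 (2 * Real.pi), c l ^ P * ENNReal.ofReal
            (‖1 - conj (z l) * (r * Complex.exp (t * Complex.I))‖ ^ (-(M * P))) :=
          lintegral_tsum fun l => ((measurable_kernel (z l) (M * P) r).const_mul _).aemeasurable
      _ = ∑' l, c l ^ P * ∫⁻ t in Ioo 0 (2 * Real.pi), ENNReal.ofReal
            (‖1 - conj (z l) * (r * Complex.exp (t * Complex.I))‖ ^ (-(M * P))) := by
          simp_rw [lintegral_const_mul _ (measurable_kernel _ _ _)]
      _ ≤ ∑' l, c l ^ P * ENNReal.ofReal (C * D ^ (1 - M * P)) := by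
          gcongr with l
          exact hC' κ (z l) hκ (hz l) r hr hr1
      _ = _ := by
          rw [ENNReal.tsum_mul_right, mul_comm]
          congr 2
          rw [← hPdef, Real.mul_rpow (by positivity) (by positivity), ← Real.rpow_mul (by positivity),
            ← Real.rpow_mul hD0.le, inv_mul_cancel₀ hP.ne', Real.rpow_one, sub_mul,
            inv_mul_cancel₀ hP.ne']
          field_simp
  -- The exponent `M - 1/p` obtained here is lowered to `M - 1 - 1/p`, so that one bound serves all
  -- `p`.
  refine key.trans ?_
  gcongr ENNReal.ofReal ?_ * _
  calc _ = (C / (2 * Real.pi)) ^ P⁻¹ * κ ^ (P⁻¹ - M) * (κ / D) ^ (M - P⁻¹) := by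
        rw [Real.div_rpow hκ.le hD0.le, mul_assoc, mul_div_assoc', ← Real.rpow_add hκ,
          show P⁻¹ - M + (M - P⁻¹) = 0 by ring, Real.rpow_zero, one_div, ← Real.rpow_neg hD0.le,
          neg_sub]
    _ ≤ _ := by
        exact mul_le_mul_of_nonneg_left
          (rpow_div_le_of_exponent_le hκ (le_max_left _ _) (by linarith)) (by positivity)

/-- Hölder with the kernel as weight: the separated sum bounds the total weight, raised to `p - 1`,
and the circle integral bounds the remaining kernel factor. For `p = ∞` the separated sum alone
suffices. -/
theorem exists_circleMean_kernelSum_le_of_separated {K M : ℝ} (hK : 1 ≤ K) (hM : 1 < M) {p : ℝ≥0∞}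
    (hp1 : 1 ≤ p) {δ : ℝ} (hδ : 0 < δ) :
    ∃ B : ℝ, 0 < B ∧ ∀ {ι : Type} [Countable ι] (κ : ℝ) (z : ι → ℂ), 0 < κ →
      (∀ l, κ / K ≤ 1 - ‖z l‖) → (∀ l, 1 - ‖z l‖ ≤ κ) →
      (∀ k l, k ≠ l → δ ≤ pseudoDist (z k) (z l)) →
      ∀ (c : ι → ℝ≥0∞) (r : ℝ), 0 ≤ r → r < 1 →
      circleMean p r (kernelSum M z c) ≤
        ENNReal.ofReal (B * κ ^ ((p⁻¹).toReal - M) *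
          (κ / max κ (1 - r)) ^ (M - 1 - (p⁻¹).toReal)) * seqNorm p c := by
  obtain ⟨A, hA, hA'⟩ := exists_tsum_rpow_le_of_separated hK hM hδ
  obtain ⟨C, hC, hC'⟩ := exists_lintegral_kernel_le hK hM
  have hpi := Real.pi_pos
  by_cases hpt : p = ∞
  · subst hpt
    refine ⟨A, hA, ?_⟩
    intro ι _ κ z hκ hz1 hz2 hsep c r hr hr1
    set D := max κ (1 - r) with hD
    have hD0 : 0 < D := lt_max_of_lt_left hκ
    rw [circleMean, seqNorm, if_pos rfl, if_pos rfl]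
    refine iSup₂_le fun ζ hζ => ?_
    rw [mem_sphere_zero_iff_norm] at hζ
    calc kernelSum M z c ζ ≤ ∑' l, (⨆ i, c i) * ENNReal.ofReal (‖1 - conj (z l) * ζ‖ ^ (-M)) := by
          unfold kernelSum
          gcongr with l
          exact le_iSup c l
      _ ≤ (⨆ i, c i) * ENNReal.ofReal (A * κ⁻¹ * D ^ (1 - M)) := by
          rw [ENNReal.tsum_mul_left]
          gcongr
          have := hA' κ z hκ hz1 hz2 hsep ζ (hζ ▸ hr1)
          rwa [hζ] at this
      _ = _ := by
          rw [mul_comm]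
          congr 2
          simp only [ENNReal.inv_top, ENNReal.toReal_zero, zero_sub, sub_zero]
          rw [Real.div_rpow hκ.le hD0.le, mul_assoc, mul_assoc, mul_div_assoc', ← Real.rpow_add hκ,
            show -M + (M - 1) = -1 by ring, Real.rpow_neg_one, div_eq_mul_inv,
            ← Real.rpow_neg hD0.le, neg_sub]
  have hp0 : p ≠ 0 := (zero_lt_one.trans_le hp1).ne'
  have hP : 0 < p.toReal := ENNReal.toReal_pos hp0 hpt
  have hP1 : 1 ≤ p.toReal := by
    have := ENNReal.toReal_mono hpt hp1
    rwa [ENNReal.toReal_one] at this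
  simp only [ENNReal.toReal_inv]
  set P := p.toReal with hPdef
  refine ⟨(A ^ (P - 1) * C / (2 * Real.pi)) ^ P⁻¹, by positivity, ?_⟩
  intro ι _ κ z hκ hz1 hz2 hsep c r hr hr1
  set D := max κ (1 - r) with hD
  have hD0 : 0 < D := lt_max_of_lt_left hκ
  have key : circleMean p r (kernelSum M z c) ≤
      ENNReal.ofReal ((A ^ (P - 1) * C / (2 * Real.pi)) ^ P⁻¹ * κ ^ (P⁻¹ - 1) * D ^ (1 - M)) *
        seqNorm p c := by
    refine circleMean_le_of_lintegral_le hp0 hpt (by positivity) ?_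
    calc _ ≤ ∫⁻ t in Ioo 0 (2 * Real.pi), ENNReal.ofReal (A * κ⁻¹ * D ^ (1 - M)) ^ (P - 1) *
            ∑' l, ENNReal.ofReal (‖1 - conj (z l) * (r * Complex.exp (t * Complex.I))‖ ^ (-M)) *
              c l ^ P := by
          refine lintegral_mono fun t => ?_
          unfold kernelSum
          simp_rw [mul_comm (c _)]
          refine (rpow_tsum_mul_le _ _ hP1).trans ?_
          gcongr
          · have hn := norm_ofReal_mul_exp hr t
            have := hA' κ z hκ hz1 hz2 hsep _ (hn.trans_lt hr1)
            rwa [hn] at this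
      _ = ENNReal.ofReal (A * κ⁻¹ * D ^ (1 - M)) ^ (P - 1) * ∑' l,
            (∫⁻ t in Ioo 0 (2 * Real.pi), ENNReal.ofReal
            (‖1 - conj (z l) * (r * Complex.exp (t * Complex.I))‖ ^ (-M))) * c l ^ P := by
          rw [lintegral_const_mul' _ _
            (ENNReal.rpow_ne_top_of_nonneg (by linarith) ENNReal.ofReal_ne_top),
            lintegral_tsum fun l => ((measurable_kernel (z l) M r).mul_const _).aemeasurable]
          simp_rw [lintegral_mul_const _ (measurable_kernel _ _ _)]
      _ ≤ ENNReal.ofReal (A * κ⁻¹ * D ^ (1 - M)) ^ (P - 1) * ∑' l,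
            ENNReal.ofReal (C * D ^ (1 - M)) * c l ^ P := by
          gcongr with l
          exact hC' κ (z l) hκ (hz1 l) r hr hr1
      _ = _ := by
          rw [ENNReal.tsum_mul_left, ← mul_assoc, ENNReal.ofReal_rpow_of_nonneg (by positivity)
            (by linarith), ← ENNReal.ofReal_mul (by positivity)]
          congr 2
          rw [← hPdef, Real.mul_rpow (by positivity) (by positivity),
            Real.mul_rpow (by positivity) (by positivity),
            Real.mul_rpow (by positivity) (by positivity),
            Real.mul_rpow (by positivity) (by positivity), Real.rpow_inv_rpow (by positivity) hP.ne',
            ← Real.rpow_mul hκ.le, ← Real.rpow_mul hD0.le, ← Real.rpow_mul hD0.le, sub_mul P⁻¹, inv_mul_cancel₀ hP.ne', one_mul,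
            Real.inv_rpow hκ.le, ← Real.rpow_neg hκ.le, neg_sub]
          rw [show (1 - M) * P = (1 - M) * (P - 1) + (1 - M) by ring, Real.rpow_add hD0]
          field_simp
  refine key.trans ?_
  gcongr ENNReal.ofReal ?_ * _
  calc _ = (A ^ (P - 1) * C / (2 * Real.pi)) ^ P⁻¹ * κ ^ (P⁻¹ - M) * (κ / D) ^ (M - 1) := by
        rw [Real.div_rpow hκ.le hD0.le, mul_assoc, mul_assoc, mul_div_assoc', ← Real.rpow_add hκ,
          show P⁻¹ - M + (M - 1) = P⁻¹ - 1 by ring, show 1 - M = -(M - 1) by ring,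
          Real.rpow_neg hD0.le, ← div_eq_mul_inv]
    _ ≤ _ := by
        have : 0 < P⁻¹ := by positivity
        exact mul_le_mul_of_nonneg_left
          (rpow_div_le_of_exponent_le hκ (le_max_left _ _) (by linarith)) (by positivity)

/-! ### Tail integrals of the weight. -/

theorem tail_antitone (ω : ℂ → ℝ≥0) : Antitone (tail ω) := fun _ _ h =>
  lintegral_mono_set (Ioo_subset_Ioo_left h)

/-- A vanishing tail at `0` stays zero by monotonicity; an infinite one stays infinite by the
exponent inequality, and `toReal` sends `∞` to `0`. -/
theorem toReal_tail_eq_zero {ω : ℂ → ℝ≥0} {β : ℝ} (hβ : IsTailExponent ω β)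
    (h : tail ω 0 = 0 ∨ tail ω 0 = ∞) {r : ℝ} (hr : 0 ≤ r) (hr1 : r < 1) :
    (tail ω r).toReal = 0 := by
  rw [ENNReal.toReal_eq_zero_iff]
  rcases h with h | h
  · exact Or.inl (le_antisymm (h ▸ tail_antitone ω hr) zero_le)
  · right
    obtain ⟨-, C, -, hC⟩ := hβ
    have := hC 0 r le_rfl hr hr1
    rw [h, top_le_iff, ENNReal.mul_eq_top] at this
    rcases this with ⟨-, h2⟩ | ⟨h2, -⟩
    · exact h2
    · exact absurd h2 ENNReal.ofReal_ne_top

theorem tail_ne_top {ω : ℂ → ℝ≥0} (h : tail ω 0 ≠ ∞) {r : ℝ} (hr : 0 ≤ r) : tail ω r ≠ ∞ :=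
  ne_top_of_le_ne_top h (tail_antitone ω hr)

theorem toReal_tail_pos {ω : ℂ → ℝ≥0} {β : ℝ} (hβ : IsTailExponent ω β) (h0 : tail ω 0 ≠ 0)
    (h : tail ω 0 ≠ ∞) {r : ℝ} (hr : 0 ≤ r) (hr1 : r < 1) : 0 < (tail ω r).toReal := by
  refine ENNReal.toReal_pos (fun h2 => h0 ?_) (tail_ne_top h hr)
  obtain ⟨-, C, -, hC⟩ := hβ
  have := hC 0 r le_rfl hr hr1
  rwa [h2, mul_zero, nonpos_iff_eq_zero] at this

theorem toReal_tail_anti {ω : ℂ → ℝ≥0} (h : tail ω 0 ≠ ∞) {r t : ℝ} (hr : 0 ≤ r) (hrt : r ≤ t) :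
    (tail ω t).toReal ≤ (tail ω r).toReal :=
  ENNReal.toReal_mono (tail_ne_top h hr) (tail_antitone ω hrt)

theorem toReal_tail_le {ω : ℂ → ℝ≥0} {β : ℝ} (hβ : IsTailExponent ω β) (h : tail ω 0 ≠ ∞) :
    ∃ C : ℝ, 0 < C ∧ ∀ r t : ℝ, 0 ≤ r → r ≤ t → t < 1 →
      (tail ω r).toReal ≤ C * ((1 - r) / (1 - t)) ^ β * (tail ω t).toReal := by
  obtain ⟨-, C, hC0, hC⟩ := hβ
  refine ⟨C, hC0, fun r t hr hrt ht => ?_⟩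
  have h1 : 0 ≤ (1 - r) / (1 - t) := div_nonneg (by linarith) (by linarith)
  have := ENNReal.toReal_mono
    (ENNReal.mul_ne_top ENNReal.ofReal_ne_top (tail_ne_top h (hr.trans hrt))) (hC r t hr hrt ht)
  rwa [ENNReal.toReal_mul, ENNReal.toReal_ofReal (by positivity)] at this

theorem radius_nonneg {K : ℝ} (hK : 1 < K) (j : ℕ) : 0 ≤ radius K j := by
  rw [radius, sub_nonneg]
  exact inv_le_one_of_one_le₀ (one_le_pow₀ hK.le)

theorem radius_lt_one {K : ℝ} (hK : 1 < K) (j : ℕ) : radius K j < 1 := by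
  rw [radius, sub_lt_self_iff]
  positivity

theorem one_sub_radius (K : ℝ) (j : ℕ) : 1 - radius K j = (K ^ j)⁻¹ := by
  rw [radius, sub_sub_cancel]

theorem radius_mono {K : ℝ} (hK : 1 < K) {i j : ℕ} (h : i ≤ j) : radius K i ≤ radius K j := by
  unfold radius
  gcongr
  exact hK.le

/-- A gain of `C` every `N` steps, spread evenly by monotonicity, is a rate `ν = C^{-1/(N+1)}` per
step. -/
theorem exists_geometric_bound {T : ℕ → ℝ} (hT : ∀ j, 0 ≤ T j) (hanti : Antitone T) {N : ℕ}
    {C : ℝ} (hC : 1 < C) (h : ∀ j, C * T (j + N) ≤ T j) :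
    ∃ A ν : ℝ, 0 < A ∧ 0 < ν ∧ ν < 1 ∧ ∀ j m, T (j + m) ≤ A * ν ^ m * T j := by
  have hC0 : 0 < C := by linarith
  -- Steps of length `N + 1` remain meaningful when `N = 0`.
  have h' : ∀ j, C * T (j + (N + 1)) ≤ T j := fun j =>
    (mul_le_mul_of_nonneg_left (hanti (by omega)) hC0.le).trans (h j)
  have hn : ∀ n j, C ^ n * T (j + n * (N + 1)) ≤ T j := by
    intro n
    induction n with
    | zero => intro j; simp
    | succ n ih =>
      intro j
      have h1 := h' (j + n * (N + 1))
      rw [show j + n * (N + 1) + (N + 1) = j + (n + 1) * (N + 1) by ring] at h1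
      calc _ = C ^ n * (C * T (j + (n + 1) * (N + 1))) := by ring
        _ ≤ C ^ n * T (j + n * (N + 1)) := by gcongr
        _ ≤ _ := ih j
  set x : ℝ := C ^ (1 / ((N : ℝ) + 1)) with hx
  have hN : (0 : ℝ) < N + 1 := by positivity
  have hx1 : 1 < x := Real.one_lt_rpow hC (by positivity)
  have hxN : x ^ (N + 1) = C := by
    rw [hx, ← Real.rpow_natCast, ← Real.rpow_mul hC0.le]
    push_cast
    rw [one_div_mul_cancel hN.ne', Real.rpow_one]
  have hx0 : 0 < x := by linarith
  refine ⟨C, x⁻¹, hC0, by positivity, inv_lt_one_of_one_lt₀ hx1, fun j m => ?_⟩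
  have h2 := hn (m / (N + 1)) j
  -- Rounding `m` down to a multiple of `N + 1` loses at most one factor `C`, which becomes the
  -- constant.
  have h3 : T (j + m) ≤ T (j + m / (N + 1) * (N + 1)) :=
    hanti (Nat.add_le_add_left (Nat.div_mul_le_self m (N + 1)) j)
  have h4 : x ^ m ≤ C * C ^ (m / (N + 1)) := by
    rw [← pow_succ', ← hxN, ← pow_mul]
    refine pow_le_pow_right₀ hx1.le ?_
    have := Nat.lt_div_mul_add (a := m) (b := N + 1) (by omega)
    rw [mul_comm (N + 1)]
    nlinarith
  rw [inv_pow, mul_assoc, mul_left_comm, inv_mul_eq_div, le_div_iff₀ (by positivity)]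
  calc T (j + m) * x ^ m ≤ T (j + m / (N + 1) * (N + 1)) * (C * C ^ (m / (N + 1))) := by
        gcongr
        exact hT _
    _ = C * (C ^ (m / (N + 1)) * T (j + m / (N + 1) * (N + 1))) := by ring
    _ ≤ C * T j := by gcongr

theorem exists_tail_radius_decay {ω : ℂ → ℝ≥0} (hω : LowerDoubling ω) (h : tail ω 0 ≠ ∞) {K : ℝ}
    (hK : 1 < K) :
    ∃ A ν : ℝ, 0 < A ∧ 0 < ν ∧ ν < 1 ∧ ∀ j m,
      (tail ω (radius K (j + m))).toReal ≤ A * ν ^ m * (tail ω (radius K j)).toReal := by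
  obtain ⟨L, C, hL, hC, H⟩ := hω
  -- With `K^N > L`, crossing `N` annuli covers at least one step of lower doubling.
  obtain ⟨N, hN⟩ := pow_unbounded_of_one_lt L hK
  refine exists_geometric_bound (T := fun j => (tail ω (radius K j)).toReal) (N := N)
    (fun _ => ENNReal.toReal_nonneg)
    (fun i j hij => toReal_tail_anti h (radius_nonneg hK i) (radius_mono hK hij)) hC fun j => ?_
  have h0 := H (radius K j) (radius_nonneg hK j) (radius_lt_one hK j)
  have h1 := ENNReal.toReal_mono (tail_ne_top h (radius_nonneg hK j)) h0
  rw [ENNReal.toReal_mul, ENNReal.toReal_ofReal (by linarith)] at h1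
  refine le_trans ?_ h1
  have h2 : 0 < (K ^ j)⁻¹ := by positivity
  refine mul_le_mul_of_nonneg_left (toReal_tail_anti h ?_ ?_) (by linarith)
  · rw [one_sub_radius, sub_nonneg]
    exact (div_le_self h2.le hL.le).trans (inv_le_one_of_one_le₀ (one_le_pow₀ hK.le))
  · rw [one_sub_radius, radius, pow_add, mul_inv, ← div_eq_mul_inv]
    gcongr

/-! ### Off-diagonal decay between annuli and bands. -/

/-- The distance of two natural numbers. -/
def gap (j k : ℕ) : ℕ := (j - k) + (k - j)

theorem gap_comm (j k : ℕ) : gap j k = gap k j := by unfold gap; omega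

theorem tsum_pow_gap_le {x : ℝ} (hx : 0 ≤ x) (hx1 : x < 1) (k : ℕ) :
    ∑' j, ENNReal.ofReal (x ^ gap j k) ≤ ENNReal.ofReal (2 * (1 - x)⁻¹) := by
  have hg : ∑' n : ℕ, ENNReal.ofReal (x ^ n) = ENNReal.ofReal ((1 - x)⁻¹) := by
    rw [← ENNReal.ofReal_tsum_of_nonneg (fun n => by positivity)
      (summable_geometric_of_lt_one hx hx1), tsum_geometric_of_lt_one hx hx1]
  have hi : 0 ≤ (1 - x)⁻¹ := inv_nonneg.2 (by linarith)
  rw [← Summable.sum_add_tsum_nat_add' (f := fun j => ENNReal.ofReal (x ^ gap j k)) (k := k)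
    ENNReal.summable, two_mul, ENNReal.ofReal_add hi hi]
  refine add_le_add ?_ ?_
  · rw [← Finset.sum_range_reflect (fun j => ENNReal.ofReal (x ^ gap j k)) k, ← hg]
    refine le_trans (Finset.sum_le_sum fun i hi => ?_)
      (ENNReal.sum_le_tsum (f := fun n => ENNReal.ofReal (x ^ n)) (Finset.range k))
    rw [Finset.mem_range] at hi
    refine ENNReal.ofReal_le_ofReal (pow_le_pow_of_le_one hx hx1.le ?_)
    unfold gap; omega
  · rw [← hg]
    refine ENNReal.tsum_le_tsum fun i => ?_
    rw [show gap (i + k) k = i by unfold gap; omega]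

theorem rpow_neg_le_of_le_mul {A a b s : ℝ} (hA : 0 < A) (ha : 0 < a) (hb : 0 < b) (hs : 0 < s)
    (h : b ≤ A * a) : a ^ (-s) ≤ A ^ s * b ^ (-s) := by
  have h1 : (A * a) ^ (-s) ≤ b ^ (-s) := Real.rpow_le_rpow_of_nonpos hb h (by linarith)
  rw [Real.mul_rpow hA.le ha.le, Real.rpow_neg hA.le, inv_mul_le_iff₀ (by positivity)] at h1
  exact h1

/-- For `j ≤ k` the tail decay gives the factor `ν^{(k-j)/q}` and the kernel ratio is at most `1`.
For `j ≥ k` the tail comparison costs `K^{(j-k)β/q}` while the kernel ratio gains `K^{-(j-k)η}`, so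
`η > β/q` is what is needed. -/
theorem exists_band_bound {ω : ℂ → ℝ≥0} (hω : LowerDoubling ω) {β : ℝ} (hβ : IsTailExponent ω β)
    (h0 : tail ω 0 ≠ 0) (h : tail ω 0 ≠ ∞) {K : ℝ} (hK : 1 < K) {q η : ℝ} (hq : 0 < q)
    (hη : β / q < η) :
    ∃ A φ : ℝ, 0 < A ∧ 0 < φ ∧ φ < 1 ∧ ∀ (j k : ℕ) (r : ℝ), r < radius K (k + 1) →
      (tail ω (radius K j)).toReal ^ (-(1 / q)) * ((K ^ j)⁻¹ / max (K ^ j)⁻¹ (1 - r)) ^ η ≤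
        A * (tail ω (radius K k)).toReal ^ (-(1 / q)) * φ ^ gap j k := by
  obtain ⟨A₁, ν, hA₁, hν, hν1, H₁⟩ := exists_tail_radius_decay hω h hK
  obtain ⟨A₂, hA₂, H₂⟩ := toReal_tail_le hβ h
  have hβ0 := hβ.1
  have hK0 : 0 < K := by linarith
  have hq' : 0 < 1 / q := by positivity
  have hη0 : 0 < η := lt_trans (by positivity) hη
  set T : ℕ → ℝ := fun j => (tail ω (radius K j)).toReal with hT
  have hTpos : ∀ j, 0 < T j := fun j =>
    toReal_tail_pos hβ h0 h (radius_nonneg hK j) (radius_lt_one hK j)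
  set φ₁ := ν ^ (1 / q) with hφ₁
  set φ₂ := K ^ (β / q - η) with hφ₂
  have hφ₁0 : 0 < φ₁ := by positivity
  have hφ₂0 : 0 < φ₂ := by positivity
  refine ⟨max (A₁ ^ (1 / q)) (A₂ ^ (1 / q) * K ^ η), max φ₁ φ₂, lt_max_of_lt_left (by positivity),
    lt_max_of_lt_left hφ₁0, max_lt (Real.rpow_lt_one hν.le hν1 hq')
      (Real.rpow_lt_one_of_one_lt_of_neg hK (by linarith)), fun j k r hr => ?_⟩
  have hD0 : 0 < max (K ^ j)⁻¹ (1 - r) := lt_max_of_lt_left (by positivity)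
  rcases le_total j k with hjk | hjk
  · obtain ⟨m, rfl⟩ := Nat.exists_eq_add_of_le hjk
    have hg : gap j (j + m) = m := by unfold gap; omega
    have h1 := rpow_neg_le_of_le_mul (by positivity) (hTpos j) (hTpos (j + m)) hq' (H₁ j m)
    have h2 : ((K ^ j)⁻¹ / max (K ^ j)⁻¹ (1 - r)) ^ η ≤ 1 :=
      Real.rpow_le_one (by positivity) ((div_le_one hD0).2 (le_max_left _ _)) hη0.le
    rw [hg]
    have hTT := hTpos (j + m)
    calc T j ^ (-(1 / q)) * ((K ^ j)⁻¹ / max (K ^ j)⁻¹ (1 - r)) ^ η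
        ≤ T j ^ (-(1 / q)) * 1 := by gcongr
      _ ≤ (A₁ * ν ^ m) ^ (1 / q) * T (j + m) ^ (-(1 / q)) := by rw [mul_one]; exact h1
      _ = A₁ ^ (1 / q) * T (j + m) ^ (-(1 / q)) * φ₁ ^ m := by
          rw [Real.mul_rpow hA₁.le (by positivity), hφ₁, ← Real.rpow_natCast, ← Real.rpow_natCast,
            ← Real.rpow_mul hν.le, ← Real.rpow_mul hν.le, mul_comm (m : ℝ)]
          ring
      _ ≤ _ := by
          gcongr
          · exact le_max_left _ _
          · exact le_max_left _ _
  · obtain ⟨m, rfl⟩ := Nat.exists_eq_add_of_le hjk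
    have hg : gap (k + m) k = m := by unfold gap; omega
    have h1 := H₂ (radius K k) (radius K (k + m)) (radius_nonneg hK k) (radius_mono hK hjk)
      (radius_lt_one hK _)
    rw [one_sub_radius, one_sub_radius, show (K ^ k)⁻¹ / (K ^ (k + m))⁻¹ = K ^ m by
      rw [pow_add]; field_simp] at h1
    have h2 := rpow_neg_le_of_le_mul (by positivity) (hTpos (k + m)) (hTpos k) hq' h1
    have h3 : (K ^ (k + m))⁻¹ / max (K ^ (k + m))⁻¹ (1 - r) ≤ K * (K ^ m)⁻¹ := by
      -- Up to the outer radius of the band, `1 - r` may be smaller than `K^{-k}` by a factor `K`;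
      -- this is the `K^η` in the constant.
      have h4 : (K ^ (k + 1))⁻¹ ≤ 1 - r := by rw [radius] at hr; linarith
      calc _ ≤ (K ^ (k + m))⁻¹ / (K ^ (k + 1))⁻¹ := by
            gcongr
            exact h4.trans (le_max_right _ _)
        _ = _ := by rw [pow_add, pow_add]; field_simp
    rw [hg]
    have hTT := hTpos k
    calc T (k + m) ^ (-(1 / q)) * ((K ^ (k + m))⁻¹ / max (K ^ (k + m))⁻¹ (1 - r)) ^ η
        ≤ ((A₂ * (K ^ m) ^ β) ^ (1 / q) * T k ^ (-(1 / q))) * (K * (K ^ m)⁻¹) ^ η := by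
          gcongr
      _ = (A₂ ^ (1 / q) * K ^ η) * T k ^ (-(1 / q)) * φ₂ ^ m := by
          rw [Real.mul_rpow hA₂.le (by positivity), Real.mul_rpow hK0.le (by positivity), hφ₂,
            Real.inv_rpow (by positivity), ← Real.rpow_neg (by positivity)]
          simp only [← Real.rpow_natCast, ← Real.rpow_mul hK0.le]
          rw [show (β / q - η) * (m : ℝ) = (m : ℝ) * β * (1 / q) + (m : ℝ) * (-η) by ring,
            Real.rpow_add hK0]
          ring
      _ ≤ _ := by
          gcongr
          · exact le_max_right _ _
          · exact le_max_right _ _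

/-! ### Size of the atoms. -/

theorem one_sub_norm_le_of_mem_annulus {K : ℝ} {j : ℕ} {w : ℂ} (hw : w ∈ annulus K j) :
    1 - ‖w‖ ≤ (K ^ j)⁻¹ := by
  have := hw.1
  rw [radius] at this
  linarith

theorem le_one_sub_norm_of_mem_annulus {K : ℝ} {j : ℕ} {w : ℂ} (hw : w ∈ annulus K j) :
    (K ^ j)⁻¹ / K ≤ 1 - ‖w‖ := by
  have := hw.2
  rw [radius, pow_succ, mul_inv, ← div_eq_mul_inv] at this
  linarith

theorem norm_atom {p : ℝ≥0∞} {q M : ℝ} {ω : ℂ → ℝ≥0} {w : ℂ} (hw : ‖w‖ ≤ 1) (ζ : ℂ) :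
    ‖atom p q M ω w ζ‖ = (1 - ‖w‖) ^ (M - (p⁻¹).toReal) * (tail ω ‖w‖).toReal ^ (-1 / q) *
      ‖1 - conj w * ζ‖ ^ (-M) := by
  have h1 : 0 ≤ 1 - ‖w‖ := by linarith
  rw [atom, norm_div, Complex.norm_cpow_real, Complex.norm_real,
    Real.norm_of_nonneg (by positivity), Real.rpow_neg (norm_nonneg _), div_eq_mul_inv]

/-- Inside one annulus `1 - ‖w‖` varies by a factor at most `K`, so the exponent inequality replaces
the tail at `‖w‖` by the tail at the inner radius at the cost of a constant. -/
theorem exists_norm_atom_le {ω : ℂ → ℝ≥0} {β : ℝ} (hβ : IsTailExponent ω β) (h0 : tail ω 0 ≠ 0)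
    (h : tail ω 0 ≠ ∞) {K : ℝ} (hK : 1 < K) {p : ℝ≥0∞} {q M : ℝ} (hq : 0 < q)
    (hM : (p⁻¹).toReal ≤ M) :
    ∃ A : ℝ, 0 < A ∧ ∀ (j : ℕ) (w ζ : ℂ), w ∈ annulus K j →
      ‖atom p q M ω w ζ‖ ≤ A * (K ^ j)⁻¹ ^ (M - (p⁻¹).toReal) *
        (tail ω (radius K j)).toReal ^ (-(1 / q)) * ‖1 - conj w * ζ‖ ^ (-M) := by
  obtain ⟨A, hA, H⟩ := toReal_tail_le hβ h
  have hK0 : 0 < K := by linarith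
  refine ⟨(A * K ^ β) ^ (1 / q), by positivity, fun j w ζ hw => ?_⟩
  have hlo := le_one_sub_norm_of_mem_annulus hw
  have hup := one_sub_norm_le_of_mem_annulus hw
  have hpos : 0 < (K ^ j)⁻¹ / K := by positivity
  have h1 : 0 ≤ 1 - ‖w‖ := by linarith
  rw [norm_atom (by linarith)]
  have hT := H (radius K j) ‖w‖ (radius_nonneg hK j) hw.1 (by linarith)
  have hT2 : (tail ω (radius K j)).toReal ≤ A * K ^ β * (tail ω ‖w‖).toReal := by
    refine hT.trans ?_
    have hd : (1 - radius K j) / (1 - ‖w‖) ≤ K := by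
      rw [one_sub_radius, div_le_iff₀ (by linarith)]
      rwa [div_le_iff₀' hK0] at hlo
    have := hβ.1.le
    gcongr
    rw [one_sub_radius]
    positivity
  have h3 := rpow_neg_le_of_le_mul (s := 1 / q) (by positivity)
    (toReal_tail_pos hβ h0 h (norm_nonneg w) (by linarith))
    (toReal_tail_pos hβ h0 h (radius_nonneg hK j) (radius_lt_one hK j)) (by positivity) hT2
  rw [neg_div]
  calc _ ≤ (K ^ j)⁻¹ ^ (M - (p⁻¹).toReal) *
        ((A * K ^ β) ^ (1 / q) * (tail ω (radius K j)).toReal ^ (-(1 / q))) *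
        ‖1 - conj w * ζ‖ ^ (-M) := by
        have : 0 ≤ M - (p⁻¹).toReal := by linarith
        gcongr
    _ = _ := by ring

/-! ### Weighted substitutes for the triangle inequality. -/

/-- Each ratio `u i / w i` is at most the `ℓ^s` quasinorm of all ratios. This holds for every `s >
0`, so no cases in the relative sizes of `p`, `q` and `1` arise. -/
theorem rpow_tsum_le_tsum_div_rpow {ι : Type*} (u w : ι → ℝ≥0∞) (hw0 : ∀ i, w i ≠ 0)
    (hwt : ∀ i, w i ≠ ∞) {s : ℝ} (hs : 0 < s) :
    (∑' i, u i) ^ s ≤ (∑' i, w i) ^ s * ∑' i, (u i / w i) ^ s := by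
  rw [← ENNReal.le_rpow_inv_iff hs, ENNReal.mul_rpow_of_nonneg _ _ (inv_nonneg.2 hs.le),
    ENNReal.rpow_rpow_inv hs.ne', ← ENNReal.tsum_mul_right]
  refine ENNReal.tsum_le_tsum fun i => ?_
  calc u i = w i * (u i / w i) := (ENNReal.mul_div_cancel (hw0 i) (hwt i)).symm
    _ ≤ _ := by
      gcongr
      rw [ENNReal.le_rpow_inv_iff hs]
      exact ENNReal.le_tsum (f := fun i => (u i / w i) ^ s) i

theorem rpow_tsum_le_tsum_div_gap {y s : ℝ} (hy : 0 < y) (hy1 : y < 1) (hs : 0 < s) (k : ℕ)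
    (u : ℕ → ℝ≥0∞) :
    (∑' j, u j) ^ s ≤ ENNReal.ofReal ((2 * (1 - y)⁻¹) ^ s) *
      ∑' j, (u j / ENNReal.ofReal (y ^ gap j k)) ^ s := by
  have hi : 0 ≤ (1 - y)⁻¹ := inv_nonneg.2 (by linarith)
  refine (rpow_tsum_le_tsum_div_rpow u (fun j => ENNReal.ofReal (y ^ gap j k))
    (fun j => by simpa using pow_pos hy _) (fun j => ENNReal.ofReal_ne_top) hs).trans ?_
  rw [← ENNReal.ofReal_rpow_of_nonneg (by positivity) hs.le]
  gcongr
  exact tsum_pow_gap_le hy.le hy1 k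

/-- For finite `p` the weighted inequality is used twice with weights `y ^ gap j k`: pointwise with
the power `p` under the integral, then with the power `q/p` on the integrated sum. -/
theorem exists_circleMean_tsum_le {p : ℝ≥0∞} (hp : p ≠ 0) {q : ℝ} (hq : 0 < q) {x : ℝ}
    (hx : 0 < x) (hx1 : x < 1) :
    ∃ C : ℝ, 0 < C ∧ ∀ (k : ℕ) (r : ℝ) (g : ℕ → ℂ → ℝ≥0∞),
      (∀ j, Measurable fun t : ℝ => g j (r * Complex.exp (t * Complex.I))) →
      circleMean p r (fun z => ∑' j, g j z) ^ q ≤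
        ENNReal.ofReal C * ∑' j, (circleMean p r (g j) / ENNReal.ofReal (x ^ gap j k)) ^ q := by
  by_cases hpt : p = ∞
  · subst hpt
    have hx2 : 0 < (1 - x)⁻¹ := inv_pos.2 (by linarith)
    refine ⟨(2 * (1 - x)⁻¹) ^ q, by positivity, fun k r g _ => ?_⟩
    refine le_trans ?_ (rpow_tsum_le_tsum_div_gap hx hx1 hq k _)
    gcongr
    simp only [circleMean, if_pos]
    exact iSup₂_le fun z hz => ENNReal.tsum_le_tsum fun j => le_iSup₂ (f := fun z _ => g j z) z hz
  have hP : 0 < p.toReal := ENNReal.toReal_pos hp hpt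
  set P := p.toReal with hPdef
  have hP2 : 0 < 1 + P⁻¹ := by positivity
  -- The two uses lose `y^{-gap}` and `y^{-gap/P}`; this choice makes the total loss exactly
  -- `x^{-gap}`.
  set y := x ^ (1 + P⁻¹)⁻¹ with hy
  have hy0 : 0 < y := by positivity
  have hy1 : y < 1 := Real.rpow_lt_one hx.le hx1 (by positivity)
  have hyx : ∀ n : ℕ, y ^ n * (y ^ n) ^ P⁻¹ = x ^ n := by
    intro n
    calc y ^ n * (y ^ n) ^ P⁻¹ = (y ^ n) ^ (1 + P⁻¹) := by
          rw [Real.rpow_add (by positivity), Real.rpow_one]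
      _ = (y ^ (1 + P⁻¹)) ^ n := by
          rw [← Real.rpow_natCast, ← Real.rpow_mul hy0.le, ← Real.rpow_natCast,
            ← Real.rpow_mul hy0.le, mul_comm]
      _ = x ^ n := by rw [hy, ← Real.rpow_mul hx.le, inv_mul_cancel₀ hP2.ne', Real.rpow_one]
  set W := 2 * (1 - y)⁻¹ with hW
  have hW0 : 0 < W := by have : 0 < (1 - y)⁻¹ := inv_pos.2 (by linarith)
                         positivity
  refine ⟨W ^ q * W ^ (q / P), by positivity, fun k r g hg => ?_⟩
  set m : ℕ → ℝ≥0∞ := fun j => circleMean p r (g j) with hm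
  set w : ℕ → ℝ≥0∞ := fun j => ENNReal.ofReal (y ^ gap j k) with hw
  have hw0 : ∀ j, w j ≠ 0 := fun j => by simpa [hw] using pow_pos hy0 _
  have hmP : ∀ j, ENNReal.ofReal (1 / (2 * Real.pi)) *
      ∫⁻ t in Ioo 0 (2 * Real.pi), g j (r * Complex.exp (t * Complex.I)) ^ P = m j ^ P := by
    intro j
    rw [hm]
    simp only [circleMean, if_neg hpt]
    rw [← hPdef, one_div P, ENNReal.rpow_inv_rpow hP.ne']
  have step : circleMean p r (fun z => ∑' j, g j z) ^ P ≤
      ENNReal.ofReal (W ^ P) * ∑' j, (m j / w j) ^ P := by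
    rw [circleMean, if_neg hpt, ← hPdef, one_div P, ENNReal.rpow_inv_rpow hP.ne']
    calc _ ≤ ENNReal.ofReal (1 / (2 * Real.pi)) * ∫⁻ t in Ioo 0 (2 * Real.pi),
            ENNReal.ofReal (W ^ P) * ∑' j, g j (r * Complex.exp (t * Complex.I)) ^ P *
              (w j)⁻¹ ^ P := by
          gcongr with t
          refine (rpow_tsum_le_tsum_div_gap hy0 hy1 hP k _).trans (le_of_eq ?_)
          simp_rw [div_eq_mul_inv, ENNReal.mul_rpow_of_nonneg _ _ hP.le]
          rfl
      _ = ENNReal.ofReal (W ^ P) * ∑' j, (ENNReal.ofReal (1 / (2 * Real.pi)) *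
            ∫⁻ t in Ioo 0 (2 * Real.pi), g j (r * Complex.exp (t * Complex.I)) ^ P) *
              (w j)⁻¹ ^ P := by
          rw [lintegral_const_mul' _ _ ENNReal.ofReal_ne_top,
            lintegral_tsum fun j => (((hg j).pow_const P).mul_const _).aemeasurable, mul_left_comm,
            ← ENNReal.tsum_mul_left]
          congr 2 with j
          rw [lintegral_mul_const _ ((hg j).pow_const P), mul_assoc]
      _ = _ := by
          simp_rw [hmP, div_eq_mul_inv, ENNReal.mul_rpow_of_nonneg _ _ hP.le]
  have hqP : 0 < q / P := by positivity
  calc circleMean p r (fun z => ∑' j, g j z) ^ q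
      = (circleMean p r (fun z => ∑' j, g j z) ^ P) ^ (q / P) := by
        rw [← ENNReal.rpow_mul]; congr 1; field_simp
    _ ≤ (ENNReal.ofReal (W ^ P) * ∑' j, (m j / w j) ^ P) ^ (q / P) := by gcongr
    _ = ENNReal.ofReal (W ^ q) * (∑' j, (m j / w j) ^ P) ^ (q / P) := by
        rw [ENNReal.mul_rpow_of_nonneg _ _ hqP.le, ENNReal.ofReal_rpow_of_nonneg (by positivity) hqP.le,
          ← Real.rpow_mul hW0.le, mul_div_cancel₀ q hP.ne']
    _ ≤ ENNReal.ofReal (W ^ q) * (ENNReal.ofReal (W ^ (q / P)) *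
          ∑' j, ((m j / w j) ^ P / w j) ^ (q / P)) := by
        gcongr
        exact rpow_tsum_le_tsum_div_gap hy0 hy1 hqP k _
    _ = _ := by
        rw [← mul_assoc, ← ENNReal.ofReal_mul (by positivity)]
        congr 2 with j
        rw [ENNReal.div_rpow_of_nonneg _ _ hqP.le, ← ENNReal.rpow_mul, mul_div_cancel₀ q hP.ne',
          ← hyx, ENNReal.ofReal_mul (by positivity),
          ← ENNReal.ofReal_rpow_of_nonneg (by positivity) (by positivity)]
        change (m j / w j) ^ q / w j ^ (q / P) = (m j / (w j * w j ^ P⁻¹)) ^ q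
        rw [ENNReal.div_rpow_of_nonneg _ _ hq.le, ENNReal.div_rpow_of_nonneg _ _ hq.le,
          ENNReal.mul_rpow_of_nonneg _ _ hq.le, ← ENNReal.rpow_mul, inv_mul_eq_div, div_eq_mul_inv,
          div_eq_mul_inv, div_eq_mul_inv (m j ^ q), mul_assoc, ENNReal.mul_inv]
        · left
          exact (ENNReal.rpow_pos (pos_iff_ne_zero.2 (hw0 j)) ENNReal.ofReal_ne_top).ne'
        · left
          exact ENNReal.rpow_ne_top_of_nonneg hq.le ENNReal.ofReal_ne_top

/-! ### Integration over the radial bands. -/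

theorem exists_mem_band {K r : ℝ} (hK : 1 < K) (hr : 0 ≤ r) (hr1 : r < 1) :
    ∃ k, r ∈ Ico (radius K k) (radius K (k + 1)) := by
  have h : 0 < 1 - r := by linarith
  obtain ⟨k, h1, h2⟩ := exists_nat_pow_near (x := (1 - r)⁻¹) (y := K)
    ((one_le_inv₀ h).2 (by linarith)) hK
  refine ⟨k, ?_, ?_⟩
  · have := (le_inv_comm₀ (by positivity) h).1 h1
    rw [radius]; linarith
  · have := (inv_lt_comm₀ h (by positivity)).1 h2
    rw [radius]; linarith

/-- The mass of `ω` on the `k`-th band is at most the tail at its inner radius, which cancels the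
inverse tail in `hf`; then the sums are interchanged and the geometric factor is summed over `k`. -/
theorem lintegral_bands_le {ω : ℂ → ℝ≥0} {K : ℝ} (hK : 1 < K) (hω : tail ω 0 ≠ ∞)
    (hpos : ∀ k, 0 < (tail ω (radius K k)).toReal) {ψ C : ℝ} (hψ : 0 < ψ) (hψ1 : ψ < 1)
    (hC : 0 ≤ C) {b : ℕ → ℝ≥0∞} (hb : ∑' j, b j ≠ ∞) {f : ℝ → ℝ≥0∞}
    (hf : ∀ k, ∀ r ∈ Ico (radius K k) (radius K (k + 1)),
      f r ≤ ENNReal.ofReal (C * ((tail ω (radius K k)).toReal)⁻¹) *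
        ∑' j, ENNReal.ofReal (ψ ^ gap j k) * b j) :
    ∫⁻ r in Ioo (0 : ℝ) 1, f r * (ω (r : ℂ) : ℝ≥0∞) ≤
      ENNReal.ofReal (C * (2 * (1 - ψ)⁻¹)) * ∑' j, b j := by
  have hsub : Ioo (0 : ℝ) 1 ⊆ ⋃ k, Ico (radius K k) (radius K (k + 1)) := fun r hr =>
    mem_iUnion.2 (exists_mem_band hK hr.1.le hr.2)
  have hband : ∀ k, ∫⁻ r in Ico (radius K k) (radius K (k + 1)), f r * (ω (r : ℂ) : ℝ≥0∞) ≤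
      ENNReal.ofReal C * ∑' j, ENNReal.ofReal (ψ ^ gap j k) * b j := by
    intro k
    set X := ∑' j, ENNReal.ofReal (ψ ^ gap j k) * b j with hX
    -- Finiteness lets constants leave the integral without measurability of `ω` along the radius.
    have hXt : X ≠ ∞ := by
      refine ne_top_of_le_ne_top hb (ENNReal.tsum_le_tsum fun j => ?_)
      refine mul_le_of_le_one_left' ?_
      rw [ENNReal.ofReal_le_one]
      exact pow_le_one₀ hψ.le hψ1.le
    calc _ ≤ ∫⁻ r in Ico (radius K k) (radius K (k + 1)),
            (ENNReal.ofReal (C * ((tail ω (radius K k)).toReal)⁻¹) * X) * (ω (r : ℂ) : ℝ≥0∞) :=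
          setLIntegral_mono' measurableSet_Ico fun r hr => mul_le_mul_left (hf k r hr) _
      _ = (ENNReal.ofReal (C * ((tail ω (radius K k)).toReal)⁻¹) * X) *
            ∫⁻ r in Ico (radius K k) (radius K (k + 1)), (ω (r : ℂ) : ℝ≥0∞) :=
          lintegral_const_mul' _ _ (ENNReal.mul_ne_top ENNReal.ofReal_ne_top hXt)
      _ ≤ (ENNReal.ofReal (C * ((tail ω (radius K k)).toReal)⁻¹) * X) * tail ω (radius K k) := by
          gcongr
          rw [tail, setLIntegral_congr (Ioo_ae_eq_Ico (a := radius K k) (b := (1 : ℝ)))]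
          exact lintegral_mono_set (Ico_subset_Ico_right (radius_lt_one hK _).le)
      _ = _ := by
          have ht := tail_ne_top hω (radius_nonneg hK k)
          rw [mul_right_comm, ← ENNReal.ofReal_toReal ht, ENNReal.toReal_ofReal
            ENNReal.toReal_nonneg, ← ENNReal.ofReal_mul (by have := hpos k; positivity), mul_assoc C,
            inv_mul_cancel₀ (hpos k).ne', mul_one]
  calc _ ≤ ∫⁻ r in ⋃ k, Ico (radius K k) (radius K (k + 1)), f r * (ω (r : ℂ) : ℝ≥0∞) :=
        lintegral_mono_set hsub
    _ ≤ ∑' k, ∫⁻ r in Ico (radius K k) (radius K (k + 1)), f r * (ω (r : ℂ) : ℝ≥0∞) :=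
        lintegral_iUnion_le _ _
    _ ≤ ∑' k, ENNReal.ofReal C * ∑' j, ENNReal.ofReal (ψ ^ gap j k) * b j :=
        ENNReal.tsum_le_tsum hband
    _ = ENNReal.ofReal C * ∑' j, (∑' k, ENNReal.ofReal (ψ ^ gap j k)) * b j := by
        rw [ENNReal.tsum_mul_left, ENNReal.tsum_comm]
        simp_rw [ENNReal.tsum_mul_right]
    _ ≤ ENNReal.ofReal C * ∑' j, ENNReal.ofReal (2 * (1 - ψ)⁻¹) * b j := by
        gcongr with j
        simp_rw [gap_comm j]
        exact tsum_pow_gap_le hψ.le hψ1 j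
    _ = _ := by rw [ENNReal.tsum_mul_left, ← mul_assoc, ← ENNReal.ofReal_mul hC]

/-! ### The mixed norm estimate. -/

instance (K : ℝ) (z : ℕ → ℂ) (j : ℕ) : Countable (Idx K z j) :=
  inferInstanceAs (Countable {k : ℕ // z k ∈ annulus K j})

theorem le_seqNorm {ι : Type} {p : ℝ≥0∞} (hp : p ≠ 0) (c : ι → ℝ≥0∞) (l : ι) :
    c l ≤ seqNorm p c := by
  unfold seqNorm
  split_ifs with h
  · exact le_iSup c l
  · have hP : 0 < p.toReal := ENNReal.toReal_pos hp h
    rw [one_div, ENNReal.le_rpow_inv_iff hP]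
    exact ENNReal.le_tsum (f := fun i => c i ^ p.toReal) l

theorem seqNorm_ofReal {ι : Type} {q : ℝ} (hq : 0 < q) (c : ι → ℝ≥0∞) :
    seqNorm (ENNReal.ofReal q) c = (∑' i, c i ^ q) ^ (1 / q) := by
  rw [seqNorm, if_neg ENNReal.ofReal_ne_top, ENNReal.toReal_ofReal hq.le]

theorem tsum_enorm_atomTerm_le {ω : ℂ → ℝ≥0} {K : ℝ} {p : ℝ≥0∞} {q M A : ℝ} (hA : 0 ≤ A)
    (hK : 0 < K)
    (hatom : ∀ (j : ℕ) (w ζ : ℂ), w ∈ annulus K j →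
      ‖atom p q M ω w ζ‖ ≤ A * (K ^ j)⁻¹ ^ (M - (p⁻¹).toReal) *
        (tail ω (radius K j)).toReal ^ (-(1 / q)) * ‖1 - conj w * ζ‖ ^ (-M))
    (z : ℕ → ℂ) (a : (j : ℕ) → Idx K z j → ℂ) (ζ : ℂ) :
    ∑' x, ‖atomTerm p q K M ω z a ζ x‖ₑ ≤ ∑' j, ENNReal.ofReal (A * (K ^ j)⁻¹ ^ (M - (p⁻¹).toReal) *
        (tail ω (radius K j)).toReal ^ (-(1 / q))) *
          kernelSum M (fun l : Idx K z j => z l.1) (fun l => ‖a j l‖ₑ) ζ := by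
  rw [ENNReal.tsum_sigma']
  refine ENNReal.tsum_le_tsum fun j => ?_
  rw [kernelSum, ← ENNReal.tsum_mul_left]
  refine ENNReal.tsum_le_tsum fun l => ?_
  rw [atomTerm, enorm_mul, mul_left_comm, ← ENNReal.ofReal_mul (by positivity)]
  gcongr
  rw [← ofReal_norm]
  exact ENNReal.ofReal_le_ofReal (hatom j (z l.1) ζ l.2)

theorem measurable_kernelSum_circle {ι : Type} [Countable ι] (M : ℝ) (z : ι → ℂ) (c : ι → ℝ≥0∞)
    (r : ℝ) : Measurable fun t : ℝ => kernelSum M z c (r * Complex.exp (t * Complex.I)) :=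
  Measurable.tsum fun l => (measurable_kernel (z l) M r).const_mul _

/-- The bound of the circle means of the kernel sums over the annuli `A_j` with constant `B`. -/
def HasKernelBound (p : ℝ≥0∞) (K M B : ℝ) (z : ℕ → ℂ) : Prop :=
  ∀ (j : ℕ) (c : Idx K z j → ℝ≥0∞) (r : ℝ), 0 ≤ r → r < 1 →
    circleMean p r (kernelSum M (fun l : Idx K z j => z l.1) c) ≤
      ENNReal.ofReal (B * (K ^ j)⁻¹ ^ ((p⁻¹).toReal - M) *
        ((K ^ j)⁻¹ / max (K ^ j)⁻¹ (1 - r)) ^ (M - 1 - (p⁻¹).toReal)) * seqNorm p c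

/-- The constant is `A * B` with `A` chosen before the sequence, so separation can influence it only
through the kernel bound `B`. -/
theorem exists_mixedNorm_atomSeries_le {ω : ℂ → ℝ≥0} (hω : LowerDoubling ω) {β : ℝ}
    (hβ : IsTailExponent ω β) (h0 : tail ω 0 ≠ 0) (h : tail ω 0 ≠ ∞) {K : ℝ} (hK : 1 < K)
    {p : ℝ≥0∞} (hp : p ≠ 0) {q M : ℝ} (hq : 0 < q) (hM : 1 + (p⁻¹).toReal + β / q < M) :
    ∃ A : ℝ, 0 < A ∧ ∀ (B : ℝ) (z : ℕ → ℂ), 0 < B → HasKernelBound p K M B z →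
      ∀ a : (j : ℕ) → Idx K z j → ℂ, mixedSeqNorm p (ENNReal.ofReal q) a < ∞ →
        mixedNorm p q ω (atomSeries p q K M ω z a) ≤
          ENNReal.ofReal (A * B) * mixedSeqNorm p (ENNReal.ofReal q) a := by
  have hK0 : 0 < K := by linarith
  have hβq : 0 < β / q := div_pos hβ.1 hq
  have hpi : 0 ≤ (p⁻¹).toReal := ENNReal.toReal_nonneg
  obtain ⟨A₁, hA₁, hatom⟩ := exists_norm_atom_le hβ h0 h hK (p := p) (M := M) hq (by linarith)
  obtain ⟨A₂, φ, hA₂, hφ, hφ1, hband⟩ := exists_band_bound hω hβ h0 h hK hq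
    (η := M - 1 - (p⁻¹).toReal) (by linarith)
  -- The decay `φ` is split in two: one factor `√φ` pays for the weighted triangle inequality, the
  -- other survives as `ψ` in the band summation.
  have hs0 : 0 < √φ := Real.sqrt_pos.2 hφ
  have hs1 : √φ < 1 := by rwa [Real.sqrt_lt' one_pos, one_pow]
  obtain ⟨C, hC, hmean⟩ := exists_circleMean_tsum_le hp hq hs0 hs1
  set T : ℕ → ℝ := fun j => (tail ω (radius K j)).toReal with hT
  have hTpos : ∀ j, 0 < T j := fun j =>
    toReal_tail_pos hβ h0 h (radius_nonneg hK j) (radius_lt_one hK j)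
  set ψ := √φ ^ q with hψ
  have hψ0 : 0 < ψ := by positivity
  have hψ1 : ψ < 1 := Real.rpow_lt_one hs0.le hs1 hq
  have hψi : 0 < (1 - ψ)⁻¹ := inv_pos.2 (by linarith)
  refine ⟨(C * (2 * (1 - ψ)⁻¹)) ^ (1 / q) * (A₁ * A₂), by positivity, fun B z hB hz a ha => ?_⟩
  set b : ℕ → ℝ≥0∞ := fun j => seqNorm p (fun l => ‖a j l‖ₑ) with hb
  have hnorm : mixedSeqNorm p (ENNReal.ofReal q) a = (∑' j, b j ^ q) ^ (1 / q) :=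
    seqNorm_ofReal hq _
  have hsum : ∑' j, b j ^ q ≠ ∞ := by
    intro htop
    rw [hnorm, htop, ENNReal.top_rpow_of_pos (by positivity)] at ha
    exact ha.ne rfl
  set g : ℕ → ℂ → ℝ≥0∞ := fun j ζ => ENNReal.ofReal (A₁ * (K ^ j)⁻¹ ^ (M - (p⁻¹).toReal) *
        T j ^ (-(1 / q))) * kernelSum M (fun l : Idx K z j => z l.1) (fun l => ‖a j l‖ₑ) ζ with hg
  have hF : ∀ ζ, ‖atomSeries p q K M ω z a ζ‖ₑ ≤ ∑' j, g j ζ := fun ζ =>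
    (enorm_tsum_le_tsum_enorm).trans (tsum_enorm_atomTerm_le hA₁.le hK0 hatom z a ζ)
  have hgm : ∀ (k : ℕ) (r : ℝ), 0 ≤ r → r < 1 → r < radius K (k + 1) → ∀ j,
      circleMean p r (g j) ≤
        ENNReal.ofReal (A₁ * A₂ * B * T k ^ (-(1 / q)) * φ ^ gap j k) * b j := by
    intro k r hr hr1 hrk j
    refine (circleMean_const_mul_le hp ENNReal.ofReal_ne_top).trans ?_
    refine (mul_le_mul_right (hz j _ r hr hr1) _).trans ?_
    have hTj := hTpos j
    rw [← mul_assoc, ← ENNReal.ofReal_mul (by positivity)]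
    gcongr ENNReal.ofReal ?_ * _
    have hκ : (0 : ℝ) < (K ^ j)⁻¹ := by positivity
    have e : (K ^ j)⁻¹ ^ (M - (p⁻¹).toReal) * (K ^ j)⁻¹ ^ ((p⁻¹).toReal - M) = 1 := by
      rw [← Real.rpow_add hκ, show M - (p⁻¹).toReal + ((p⁻¹).toReal - M) = 0 by ring,
        Real.rpow_zero]
    calc _ = ((K ^ j)⁻¹ ^ (M - (p⁻¹).toReal) * (K ^ j)⁻¹ ^ ((p⁻¹).toReal - M)) * (A₁ * B *
          (T j ^ (-(1 / q)) *
            ((K ^ j)⁻¹ / max (K ^ j)⁻¹ (1 - r)) ^ (M - 1 - (p⁻¹).toReal))) := by ring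
      _ ≤ A₁ * B * (A₂ * T k ^ (-(1 / q)) * φ ^ gap j k) := by
          rw [e, one_mul]
          exact mul_le_mul_of_nonneg_left (hband j k r hrk) (by positivity)
      _ = _ := by ring
  have hkey : ∀ k, ∀ r ∈ Ico (radius K k) (radius K (k + 1)),
      integralMean p r (atomSeries p q K M ω z a) ^ q ≤
        ENNReal.ofReal (C * (A₁ * A₂ * B) ^ q * (T k)⁻¹) *
          ∑' j, ENNReal.ofReal (ψ ^ gap j k) * b j ^ q := by
    intro k r hr
    have hr0 : 0 ≤ r := (radius_nonneg hK k).trans hr.1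
    have hr1 : r < 1 := hr.2.trans (radius_lt_one hK _)
    have hTk := hTpos k
    rw [integralMean_eq_circleMean]
    calc _ ≤ circleMean p r (fun ζ => ∑' j, g j ζ) ^ q := by
          gcongr
          exact circleMean_mono hr0 fun ζ _ => hF ζ
      _ ≤ ENNReal.ofReal C * ∑' j, (circleMean p r (g j) / ENNReal.ofReal (√φ ^ gap j k)) ^ q :=
          hmean k r g fun j => (measurable_kernelSum_circle M _ _ r).const_mul _
      _ ≤ ENNReal.ofReal C * ∑' j, ENNReal.ofReal ((A₁ * A₂ * B) ^ q * (T k)⁻¹) *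
            (ENNReal.ofReal (ψ ^ gap j k) * b j ^ q) := by
          gcongr with j
          calc _ ≤ (ENNReal.ofReal (A₁ * A₂ * B * T k ^ (-(1 / q)) * φ ^ gap j k) * b j /
                ENNReal.ofReal (√φ ^ gap j k)) ^ q := by
                gcongr
                exact hgm k r hr0 hr1 hr.2 j
            _ = (ENNReal.ofReal (A₁ * A₂ * B * T k ^ (-(1 / q)) * √φ ^ gap j k) * b j) ^ q := by
                rw [mul_comm, mul_div_assoc, ← ENNReal.ofReal_div_of_pos (by positivity), mul_comm]
                congr 3
                rw [mul_div_assoc, ← div_pow, Real.div_sqrt]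
            _ = _ := by
                rw [ENNReal.mul_rpow_of_nonneg _ _ hq.le, ENNReal.ofReal_rpow_of_nonneg
                  (by positivity) hq.le, ← mul_assoc, ← ENNReal.ofReal_mul (by positivity)]
                congr 2
                rw [Real.mul_rpow (by positivity) (by positivity),
                  Real.mul_rpow (by positivity) (by positivity), ← Real.rpow_mul hTk.le, neg_mul,
                  one_div_mul_cancel hq.ne', Real.rpow_neg_one, hψ, ← Real.rpow_natCast,
                  ← Real.rpow_natCast, ← Real.rpow_mul hs0.le, ← Real.rpow_mul hs0.le,
                  mul_comm (gap j k : ℝ)]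
      _ = _ := by
          rw [ENNReal.tsum_mul_left, ← mul_assoc, ← ENNReal.ofReal_mul hC.le, ← mul_assoc]
  have hfin := lintegral_bands_le hK h hTpos hψ0 hψ1 (by positivity) hsum hkey
  have hq' : 0 < 1 / q := by positivity
  rw [mixedNorm, hnorm]
  calc _ ≤ (ENNReal.ofReal (C * (A₁ * A₂ * B) ^ q * (2 * (1 - ψ)⁻¹)) * ∑' j, b j ^ q) ^ (1 / q) := by
        gcongr
    _ = _ := by
        rw [ENNReal.mul_rpow_of_nonneg _ _ hq'.le, ENNReal.ofReal_rpow_of_nonneg (by positivity) hq'.le,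
          mul_right_comm C, Real.mul_rpow (by positivity) (by positivity), ← Real.rpow_mul (by positivity),
          mul_one_div_cancel hq.ne', Real.rpow_one]
        congr 2
        ring

/-! ### Absolute convergence and analyticity. -/

/-- Every coefficient is bounded by the full sequence norm and `A_j` holds at most a constant times
`K^j` points; the band bound with `k = 0`, `r = 0` then makes the sum over `j` geometric. -/
theorem tsum_enorm_atomTerm_zero_ne_top {ω : ℂ → ℝ≥0} (hω : LowerDoubling ω) {β : ℝ}
    (hβ : IsTailExponent ω β) (h0 : tail ω 0 ≠ 0) (h : tail ω 0 ≠ ∞) {K : ℝ} (hK : 1 < K)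
    {p : ℝ≥0∞} (hp : p ≠ 0) {q M : ℝ} (hq : 0 < q) (hM : 1 + (p⁻¹).toReal + β / q < M)
    {δ : ℝ} (hδ : 0 < δ) {z : ℕ → ℂ} (hz : IsSeparatedBy δ z) {a : (j : ℕ) → Idx K z j → ℂ}
    (ha : mixedSeqNorm p (ENNReal.ofReal q) a < ∞) :
    ∑' x, ‖atomTerm p q K M ω z a 0 x‖ₑ ≠ ∞ := by
  have hK0 : 0 < K := by linarith
  have hβq : 0 < β / q := div_pos hβ.1 hq
  have hpi : 0 ≤ (p⁻¹).toReal := ENNReal.toReal_nonneg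
  obtain ⟨A₁, hA₁, hatom⟩ := exists_norm_atom_le hβ h0 h hK (p := p) (M := M) hq (by linarith)
  obtain ⟨A₂, φ, hA₂, hφ, hφ1, hband⟩ := exists_band_bound hω hβ h0 h hK hq
    (η := M - 1 - (p⁻¹).toReal) (by linarith)
  obtain ⟨N, hN, hcount⟩ := exists_tsum_rpow_le_of_separated hK.le (M := M) (by linarith) hδ
  set S := mixedSeqNorm p (ENNReal.ofReal q) a with hS
  set T₀ := (tail ω (radius K 0)).toReal ^ (-(1 / q)) with hT₀
  have hcS : ∀ j l, ‖a j l‖ₑ ≤ S := fun j l =>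
    (le_seqNorm hp (fun l => ‖a j l‖ₑ) l).trans
      (le_seqNorm (by simpa using hq) (fun j => seqNorm p (fun l => ‖a j l‖ₑ)) j)
  have hT0 : 0 ≤ T₀ := by positivity
  refine ne_top_of_le_ne_top ?_ (tsum_enorm_atomTerm_le hA₁.le hK0 hatom z a 0)
  have hterm : ∀ j, ENNReal.ofReal (A₁ * (K ^ j)⁻¹ ^ (M - (p⁻¹).toReal) *
        (tail ω (radius K j)).toReal ^ (-(1 / q))) *
          kernelSum M (fun l : Idx K z j => z l.1) (fun l => ‖a j l‖ₑ) 0 ≤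
      ENNReal.ofReal (A₁ * N * (A₂ * T₀)) * S * ENNReal.ofReal (φ ^ gap j 0) := by
    intro j
    have hκ : (0 : ℝ) < (K ^ j)⁻¹ := by positivity
    have hκ1 : (K ^ j)⁻¹ ≤ 1 := inv_le_one_of_one_le₀ (one_le_pow₀ hK.le)
    -- At `ζ = 0` every kernel equals `1`, so the separated sum counts the points in `A_j`.
    have hc := hcount (K ^ j)⁻¹ (fun l : Idx K z j => z l.1) hκ
      (fun l => le_one_sub_norm_of_mem_annulus l.2) (fun l => one_sub_norm_le_of_mem_annulus l.2)
      (fun k l hkl => hz.le_dist _ _ fun e => hkl (Subtype.ext e)) 0 (by simp)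
    rw [norm_zero, sub_zero, max_eq_right hκ1, Real.one_rpow, mul_one] at hc
    have hb := hband j 0 0 (by rw [radius]; simpa using inv_lt_one_of_one_lt₀ hK)
    rw [sub_zero, max_eq_right hκ1, div_one] at hb
    calc _ ≤ ENNReal.ofReal (A₁ * (K ^ j)⁻¹ ^ (M - (p⁻¹).toReal) *
          (tail ω (radius K j)).toReal ^ (-(1 / q))) * (S * ENNReal.ofReal (N * (K ^ j)⁻¹⁻¹)) := by
          gcongr
          rw [kernelSum]
          refine le_trans (ENNReal.tsum_le_tsum fun l => mul_le_mul_left (hcS j l) _) ?_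
          rw [ENNReal.tsum_mul_left]
          gcongr
      _ = ENNReal.ofReal (A₁ * N * ((tail ω (radius K j)).toReal ^ (-(1 / q)) *
            (K ^ j)⁻¹ ^ (M - 1 - (p⁻¹).toReal))) * S := by
          rw [mul_comm S, ← mul_assoc, ← ENNReal.ofReal_mul (by positivity)]
          congr 2
          rw [show M - 1 - (p⁻¹).toReal = M - (p⁻¹).toReal + (-1) by ring, Real.rpow_add hκ,
            Real.rpow_neg_one]
          ring
      _ ≤ ENNReal.ofReal (A₁ * N * (A₂ * T₀ * φ ^ gap j 0)) * S := by
          gcongr ?_ * S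
          exact ENNReal.ofReal_le_ofReal (mul_le_mul_of_nonneg_left hb (by positivity))
      _ = _ := by
          rw [mul_right_comm (ENNReal.ofReal _) S, ← ENNReal.ofReal_mul (by positivity),
            mul_assoc (A₁ * N)]
  refine ne_top_of_le_ne_top ?_ (ENNReal.tsum_le_tsum hterm)
  rw [ENNReal.tsum_mul_left]
  exact ENNReal.mul_ne_top (ENNReal.mul_ne_top ENNReal.ofReal_ne_top ha.ne)
    (ne_top_of_le_ne_top ENNReal.ofReal_ne_top (tsum_pow_gap_le hφ.le hφ1 0))

/-- Reduces convergence, uniformly on `‖ζ‖ ≤ ρ`, to convergence at the origin, because the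
denominator stays at least `1 - ρ` in modulus. -/
theorem norm_atomTerm_le {ω : ℂ → ℝ≥0} {K : ℝ} {p : ℝ≥0∞} {q M : ℝ} (hM : 0 ≤ M) {z : ℕ → ℂ}
    (hz : ∀ k, ‖z k‖ < 1) (a : (j : ℕ) → Idx K z j → ℂ) {ρ : ℝ} (hρ : ρ < 1) {ζ : ℂ} (hζ : ‖ζ‖ ≤ ρ)
    (x : Σ j : ℕ, Idx K z j) :
    ‖atomTerm p q K M ω z a ζ x‖ ≤ ‖atomTerm p q K M ω z a 0 x‖ * (1 - ρ) ^ (-M) := by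
  have hw := hz x.2.1
  rw [atomTerm, atomTerm, norm_mul, norm_mul, norm_atom hw.le, norm_atom hw.le, mul_zero, sub_zero,
    norm_one, Real.one_rpow, mul_one, mul_assoc ‖a x.1 x.2‖]
  have h1 : 0 ≤ 1 - ‖z x.2.1‖ := by linarith
  have h3 := norm_sub_norm_le (1 : ℂ) (conj (z x.2.1) * ζ)
  rw [norm_one, norm_mul, Complex.norm_conj] at h3
  have h4 : 1 - ρ ≤ ‖1 - conj (z x.2.1) * ζ‖ := by
    nlinarith [norm_nonneg (z x.2.1), norm_nonneg ζ]
  refine mul_le_mul_of_nonneg_left (mul_le_mul_of_nonneg_left ?_ (by positivity)) (norm_nonneg _)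
  exact Real.rpow_le_rpow_of_nonpos (by linarith) h4 (by linarith)

theorem differentiableAt_atomTerm {ω : ℂ → ℝ≥0} {K : ℝ} {p : ℝ≥0∞} {q M : ℝ} {z : ℕ → ℂ}
    (hz : ∀ k, ‖z k‖ < 1) (a : (j : ℕ) → Idx K z j → ℂ) {ζ : ℂ} (hζ : ‖ζ‖ < 1)
    (x : Σ j : ℕ, Idx K z j) :
    DifferentiableAt ℂ (fun ζ => atomTerm p q K M ω z a ζ x) ζ := by
  have h1 : ‖conj (z x.2.1) * ζ‖ < 1 := by
    rw [norm_mul, Complex.norm_conj]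
    nlinarith [norm_nonneg (z x.2.1), norm_nonneg ζ, hz x.2.1]
  have h2 : 1 - conj (z x.2.1) * ζ ∈ Complex.slitPlane := by
    rw [Complex.mem_slitPlane_iff]
    left
    have := (Complex.abs_re_le_norm (conj (z x.2.1) * ζ)).trans_lt h1
    rw [Complex.sub_re, Complex.one_re]
    linarith [le_abs_self (conj (z x.2.1) * ζ).re]
  unfold atomTerm atom
  have h3 : DifferentiableAt ℂ (fun ζ : ℂ => 1 - conj (z x.2.1) * ζ) ζ :=
    (differentiableAt_id.const_mul _).const_sub _
  have h4 : DifferentiableAt ℂ (fun ζ : ℂ => (1 - conj (z x.2.1) * ζ) ^ (M : ℂ)) ζ :=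
    h3.cpow (differentiableAt_const _) h2
  have h5 : (1 - conj (z x.2.1) * ζ) ^ (M : ℂ) ≠ 0 := by
    rw [Complex.cpow_ne_zero_iff]
    exact Or.inl (Complex.slitPlane_ne_zero h2)
  exact ((differentiableAt_const _).div h4 h5).const_mul _

theorem summable_atomTerm {ω : ℂ → ℝ≥0} {K : ℝ} {p : ℝ≥0∞} {q M : ℝ} (hM : 0 ≤ M) {z : ℕ → ℂ}
    (hz : ∀ k, ‖z k‖ < 1) {a : (j : ℕ) → Idx K z j → ℂ}
    (hs : Summable fun x => ‖atomTerm p q K M ω z a 0 x‖) {ζ : ℂ} (hζ : ‖ζ‖ < 1) :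
    Summable (atomTerm p q K M ω z a ζ) :=
  Summable.of_norm_bounded (hs.mul_right _) fun x => norm_atomTerm_le hM hz a hζ le_rfl x

theorem analyticOnNhd_atomSeries {ω : ℂ → ℝ≥0} {K : ℝ} {p : ℝ≥0∞} {q M : ℝ} (hM : 0 ≤ M)
    {z : ℕ → ℂ} (hz : ∀ k, ‖z k‖ < 1) {a : (j : ℕ) → Idx K z j → ℂ}
    (hs : Summable fun x => ‖atomTerm p q K M ω z a 0 x‖) :
    AnalyticOnNhd ℂ (atomSeries p q K M ω z a) (ball (0 : ℂ) 1) := by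
  refine DifferentiableOn.analyticOnNhd (fun ζ hζ => ?_) isOpen_ball
  rw [mem_ball_zero_iff] at hζ
  obtain ⟨ρ, hρ, hρ1⟩ := exists_between hζ
  have hd : DifferentiableOn ℂ (atomSeries p q K M ω z a) (ball (0 : ℂ) ρ) :=
    Complex.differentiableOn_tsum_of_summable_norm (F := fun x ζ => atomTerm p q K M ω z a ζ x)
      (hs.mul_right ((1 - ρ) ^ (-M)))
      (fun x w hw => (differentiableAt_atomTerm hz a
        ((mem_ball_zero_iff.1 hw).trans hρ1) x).differentiableWithinAt) isOpen_ball
      (fun x w hw => norm_atomTerm_le hM hz a hρ1 (mem_ball_zero_iff.1 hw).le x)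
  exact (hd.differentiableAt (isOpen_ball.mem_nhds (mem_ball_zero_iff.2 hρ))).differentiableWithinAt

/-! ### Choice of constants and the degenerate weight. -/

theorem exists_hasKernelBound {K M : ℝ} (hK : 1 < K) {p : ℝ≥0∞} (hp : 0 < p)
    (hM : 1 + (p⁻¹).toReal < M) :
    ∃ B : ℝ → ℝ, (∀ δ, 0 < B δ) ∧ (p ≤ 1 → ∀ δ δ', B δ = B δ') ∧
      ∀ δ, 0 < δ → ∀ z, IsSeparatedBy δ z → HasKernelBound p K M (B δ) z := by
  have hK0 : 0 < K := by linarith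
  have hpi : 0 ≤ (p⁻¹).toReal := ENNReal.toReal_nonneg
  rcases le_or_gt p 1 with hp1 | hp1
  · obtain ⟨B, hB, H⟩ := exists_circleMean_kernelSum_le_of_le_one hK.le hp hp1 (M := M) (by linarith)
    exact ⟨fun _ => B, fun _ => hB, fun _ _ _ => rfl, fun δ _ z hz j c r hr hr1 =>
      H (K ^ j)⁻¹ _ (by positivity) (fun l => le_one_sub_norm_of_mem_annulus l.2) c r hr hr1⟩
  · have : ∀ δ : ℝ, ∃ B : ℝ, 0 < B ∧
        (0 < δ → ∀ z, IsSeparatedBy δ z → HasKernelBound p K M B z) := by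
      intro δ
      by_cases hδ : 0 < δ
      · obtain ⟨B, hB, H⟩ := exists_circleMean_kernelSum_le_of_separated hK.le (M := M) (by linarith)
          hp1.le hδ
        exact ⟨B, hB, fun _ z hz j c r hr hr1 => H (K ^ j)⁻¹ _ (by positivity)
          (fun l => le_one_sub_norm_of_mem_annulus l.2)
          (fun l => one_sub_norm_le_of_mem_annulus l.2)
          (fun k l hkl => hz.le_dist _ _ fun e => hkl (Subtype.ext e)) c r hr hr1⟩
      · exact ⟨1, one_pos, fun hδ' => absurd hδ' hδ⟩
    choose B hB H using this
    exact ⟨B, hB, fun h => absurd h hp1.not_ge, H⟩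

/-- The tail reads as `0` throughout the disc, and `0 ^ (-1 / q) = 0` for real powers. -/
theorem atomTerm_eq_zero {ω : ℂ → ℝ≥0} {β : ℝ} (hβ : IsTailExponent ω β)
    (h : tail ω 0 = 0 ∨ tail ω 0 = ∞) {K : ℝ} {p : ℝ≥0∞} {q M : ℝ} (hq : 0 < q) {z : ℕ → ℂ}
    (hz : ∀ k, ‖z k‖ < 1) (a : (j : ℕ) → Idx K z j → ℂ) (ζ : ℂ) :
    atomTerm p q K M ω z a ζ = 0 := by
  funext x
  have hq' : -1 / q ≠ 0 := div_ne_zero (by norm_num) hq.ne'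
  rw [atomTerm, atom, toReal_tail_eq_zero hβ h (norm_nonneg _) (hz _), Real.zero_rpow hq', mul_zero,
    Complex.ofReal_zero, zero_div, mul_zero, Pi.zero_apply]

theorem mixedNorm_zero {p : ℝ≥0∞} (hp : p ≠ 0) {q : ℝ} (hq : 0 < q) (ω : ℂ → ℝ≥0) :
    mixedNorm p q ω (fun _ => 0) = 0 := by
  have h : ∀ r, integralMean p r (fun _ => 0) = 0 := by
    intro r
    unfold integralMean
    split_ifs with hpt
    · simp
    · have hP : 0 < p.toReal := ENNReal.toReal_pos hp hpt
      simp [ENNReal.zero_rpow_of_pos hP, hP]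
  unfold mixedNorm
  simp [h, ENNReal.zero_rpow_of_pos hq, hq]

end AtomicDecomp

open AtomicDecomp in
theorem theorem1 (p : ℝ≥0∞) (hp : 0 < p) (q : ℝ) (hq : 0 < q) (K : ℝ) (hK : 1 < K)
    (ω : ℂ → ℝ≥0) (hω : IsDoublingWeight ω)
    (β γ : ℝ) (hβ : IsTailExponent ω β) (hγ : IsIntegralExponent ω γ)
    (M : ℝ) (hM : 1 + (p⁻¹).toReal + (β + γ) / q < M) :
    ∃ C : ℝ → ℝ, (∀ δ, 0 < C δ) ∧ (p ≤ 1 → ∀ δ δ', C δ = C δ') ∧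
      ∀ δ : ℝ, 0 < δ → ∀ z : ℕ → ℂ, IsSeparatedBy δ z →
        ∀ a : (j : ℕ) → Idx K z j → ℂ, mixedSeqNorm p (ENNReal.ofReal q) a < ∞ →
          (∀ ζ ∈ ball (0 : ℂ) 1, Summable (atomTerm p q K M ω z a ζ)) ∧
          MemMixedNormSpace p q ω (atomSeries p q K M ω z a) ∧
          mixedNorm p q ω (atomSeries p q K M ω z a)
            ≤ ENNReal.ofReal (C δ) * mixedSeqNorm p (ENNReal.ofReal q) a := by
  -- In the degenerate cases the series is identically zero; otherwise the tail is positive and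
  -- finite at every radius in `[0, 1)`.
  by_cases hdeg : tail ω 0 = 0 ∨ tail ω 0 = ∞
  · refine ⟨fun _ => 1, fun _ => one_pos, fun _ _ _ => rfl, fun δ _ z hz a _ => ?_⟩
    have h0 := atomTerm_eq_zero hβ hdeg (K := K) (p := p) (M := M) hq hz.mem_disc a
    have hF : atomSeries p q K M ω z a = fun _ => 0 := by
      funext ζ
      rw [atomSeries, h0 ζ]
      exact tsum_zero
    have hn : mixedNorm p q ω (atomSeries p q K M ω z a) = 0 := by
      rw [hF, mixedNorm_zero hp.ne' hq]
    refine ⟨fun ζ _ => ?_, ⟨?_, ?_⟩, ?_⟩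
    · rw [h0 ζ]
      exact summable_zero
    · rw [hF]
      exact analyticOnNhd_const
    · rw [hn]
      exact ENNReal.zero_lt_top
    · rw [hn]
      exact zero_le
  · rw [not_or] at hdeg
    have hpi : 0 ≤ (p⁻¹).toReal := ENNReal.toReal_nonneg
    have hβq : 0 < β / q := div_pos hβ.1 hq
    have hγq : 0 < γ / q := div_pos hγ.1 hq
    -- Since `γ / q` is positive, `M - 1 - 1/p` exceeds `β / q`, as the band bound requires.
    rw [add_div] at hM
    have hM' : 1 + (p⁻¹).toReal + β / q < M := by linarith
    obtain ⟨B, hB, hBconst, hBker⟩ := exists_hasKernelBound hK hp (M := M) (by linarith)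
    obtain ⟨A, hA, hnorm⟩ :=
      exists_mixedNorm_atomSeries_le hω.lower hβ hdeg.1 hdeg.2 hK hp.ne' hq hM'
    refine ⟨fun δ => A * B δ, fun δ => mul_pos hA (hB δ),
      fun h1 δ δ' => congrArg (A * ·) (hBconst h1 δ δ'), fun δ hδ z hz a ha => ?_⟩
    have hle := hnorm (B δ) z (hB δ) (hBker δ hδ z hz) a ha
    have hs : Summable fun x => ‖atomTerm p q K M ω z a 0 x‖ := by
      have ht := tsum_enorm_atomTerm_zero_ne_top hω.lower hβ hdeg.1 hdeg.2 hK hp.ne' hq hM' hδ hz ha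
      simpa using ENNReal.summable_toReal ht
    have hM0 : 0 ≤ M := by linarith
    exact ⟨fun ζ hζ => summable_atomTerm hM0 hz.mem_disc hs (mem_ball_zero_iff.1 hζ),
      ⟨analyticOnNhd_atomSeries hM0 hz.mem_disc hs,
        hle.trans_lt (ENNReal.mul_lt_top ENNReal.ofReal_lt_top ha)⟩, hle⟩
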